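/- **Standard central limit theorem for random pseudomatrices.** *Matricial freeness.* Let $\mathcal A$ be a unital $*$-algebra over $\mathbb C$; a state is a normalized positive linear functional. Let $\varphi$ be a (distinguished) state and $(\varphi_j)_{j\in I}$ states (conditions) on $\mathcal A$, and put $\varphi_{j,j}=\varphi$ and $\varphi_{i,j}=\varphi_j$ for $i\ne j$. Let $\Lambda$ be the set of words $((i_1,i_2),(i_2,i_3),\dots,(i_m,i_m))$, $m\ge 1$, whose consecutive pairs are different. An array $(a_{i,j})_{i,j\in I}$ of self-adjoint elements of $\mathcal A$ is matricially free with respect to $(\varphi_{i,j})$ if there are commuting projections $1_{i,j}\in\mathcal A$ with $1_{i,j}a_{i,j}=a_{i,j}=a_{i,j}1_{i,j}$, $\varphi(1_{i,j})=\delta_{i,j}$ and $\varphi_j(1_{i,k})=\delta_{j,k}$, such that, with $\mathcal A_{i,j}=\mathbb C[a_{i,j},1_{i,j}]$ and $\mathcal I$ the unital algebra generated by all $1_{i,j}$: 1. $\varphi(b_1\cdots b_m)=0$ whenever $m\ge1$, $b_k\in\mathcal A_{i_k,j_k}\cap\operatorname{Ker}\varphi_{i_k,j_k}$ and $(i_1,j_1)\neq\dots\neq(i_m,j_m)$;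 2. $\varphi(u_1au_2)=\varphi(u_1)\varphi(a)\varphi(u_2)$ for $a\in\mathcal A$, $u_1,u_2\in\mathcal I$; 3. if $r<m$, $a\in\mathcal A$, $(i_r,j_r)\ne\dots\ne(i_m,j_m)$ and $b_k\in\mathcal A_{i_k,j_k}\cap\operatorname{Ker}\varphi_{i_k,j_k}$ for $r<k\le m$, then $\varphi(a\,1_{i_r,j_r}b_{r+1}\cdots b_m)$ equals $\varphi(a\,b_{r+1}\cdots b_m)$ if $((i_r,j_r),\dots,(i_m,j_m))\in\Lambda$, and $0$ otherwise. *Assumptions.* Let $d_1,\dots,d_r>0$ with $\sum_k d_k=1$, let $D=\operatorname{diag}(d_1,\dots,d_r)$, and let $U=(u_{k,l})\in M_r(\mathbb R)$ with $u_{k,k}>0$ and $u_{k,l}\ge0$. For each $n$ split $[n]=\{1,\dots,n\}$ into consecutive intervals $N_1,\dots,N_r$ of lengths $n_k=\lfloor (d_1+\dots+d_k)n\rfloor-\lfloor (d_1+\dots+d_{k-1})n\rfloor$. For each $n$ let $\mathcal A_n$ be a unital $*$-algebra with a state $\phi_n$ and conditions $\psi_{n,1},\dots,\psi_{n,n}$,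 put $\phi_{j,j}(n)=\phi_n$ and $\phi_{i,j}(n)=\psi_{n,j}$ for $i\neq j$, and let $(X_{i,j}(n))_{1\le i,j\le n}$ be an array of self-adjoint elements of $\mathcal A_n$ that is matricially free with respect to $(\phi_{i,j}(n))$. Assume that $\phi_{i,j}(n)(X_{i,j}(n))=0$, that $\phi_{i,j}(n)(X_{i,j}(n)^2)=u_{k,l}/n$ for $i\in N_k$, $j\in N_l$, and that for every $m$ there is $M_m\ge0$ with $|\phi_{i,j}(n)(X_{i,j}(n)^m)|\le M_m n^{-m/2}$ for all $n$ and all $i,j\in[n]$. Let $S(n)=\sum_{i,j=1}^nX_{i,j}(n)$. *Conclusion.* For a probability measure $\mu$ on $\mathbb R$ write $G_\mu(z)=\int\frac{\mu(dx)}{z-x}$ and $K_\mu(z)=z-1/G_\mu(z)$, $z\in\mathbb C^+$. Let $B=(b_{i,j})=DU$, and define $K^{(0)}_{i,j}(z)=b_{i,j}/z$ and $K^{(m+1)}_{i,j}(z)=b_{i,j}/\bigl(z-\sum_pK^{(m)}_{p,i}(z)\bigr)$. Then $K^{(m)}_{i,j}$ converges, uniformly on compact subsets of $\mathbb C^+$,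 to a function $K_{i,j}$ (a continued fraction), which is the K-transform of a probability measure $\mu_{i,j}$ on $\mathbb R$. Moreover the boolean additive convolution $\mu_0=\mu_{1,1}\uplus\dots\uplus\mu_{r,r}$, that is, a probability measure with $K_{\mu_0}=\sum_jK_{\mu_{j,j}}$ on $\mathbb C^+$, exists, its Cauchy transform is $$G_{\mu_0}(z)=\frac1{z-\sum_{j=1}^rK_{j,j}(z)},\qquad z\in\mathbb C^+,$$ and the $\phi_n$-distributions of $S(n)$ converge weakly to $\mu_0$: $\mu_0$ has moments of all orders and $\phi_n(S(n)^m)\to\int x^m\,\mu_0(dx)$ for every $m\ge0$; and whenever $\nu_n$ are probability measures on $\mathbb R$ whose moments of all orders exist and equal $\phi_n(S(n)^m)$, then $\nu_n\to\mu_0$ weakly. -/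

import Mathlib

open MeasureTheory Filter Topology

/-! ## Matricial freeness -/

namespace MatFree

/-- A state on a unital `*`-algebra: a normalized positive linear functional. -/
structure IsState {A : Type*} [Ring A] [StarRing A] [Algebra ℂ A] (φ : A →ₗ[ℂ] ℂ) : Prop where
  map_one : φ 1 = 1
  nonneg : ∀ a : A, 0 ≤ (φ (star a * a)).re
  real : ∀ a : A, (φ (star a * a)).im = 0

/-- The array of states defined by the distinguished state `φ` and the conditions `ψ j`:
`φ` on the diagonal and `ψ j` at the off-diagonal entries of column `j`. -/
def stateArray {ι A : Type*} [DecidableEq ι] [Ring A] [Algebra ℂ A]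
    (φ : A →ₗ[ℂ] ℂ) (ψ : ι → A →ₗ[ℂ] ℂ) (p : ι × ι) : A →ₗ[ℂ] ℂ :=
  if p.1 = p.2 then φ else ψ p.2

/-- The set `Λ` of nonempty words `((i₁,i₂), (i₂,i₃), …, (iₙ,iₙ))` in which consecutive pairs
are different and whose last pair is diagonal. -/
def Lam (ι : Type*) : Set (List (ι × ι)) :=
  {w | w ≠ [] ∧ w.IsChain (fun p q => p.2 = q.1 ∧ p ≠ q) ∧ ∀ p ∈ w.getLast?, p.1 = p.2}

/-- `w` is a word of letters `(p, a)` with `a ∈ 𝒜 p` and `φ_p(a) = 0`, where `φ_p` is the entry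
at `p` of the array of states defined by `φ` and `ψ`. -/
def IsCentered {ι A : Type*} [DecidableEq ι] [Ring A] [Algebra ℂ A]
    (𝒜 : ι × ι → NonUnitalSubalgebra ℂ A) (φ : A →ₗ[ℂ] ℂ) (ψ : ι → A →ₗ[ℂ] ℂ)
    (w : List ((ι × ι) × A)) : Prop :=
  ∀ x ∈ w, x.2 ∈ 𝒜 x.1 ∧ stateArray φ ψ x.1 x.2 = 0

/-- The standing assumptions: each subalgebra `𝒜 (i, j)` has the internal unit `e (i, j)`,
the internal units commute with each other (so that they generate a commutative algebra), and
`φ(e (i, j)) = δ_{i,j}`, `ψ_j(e (i, k)) = δ_{j,k}`. -/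
structure HasInternalUnits {ι A : Type*} [DecidableEq ι] [Ring A] [Algebra ℂ A]
    (𝒜 : ι × ι → NonUnitalSubalgebra ℂ A) (e : ι × ι → A)
    (φ : A →ₗ[ℂ] ℂ) (ψ : ι → A →ₗ[ℂ] ℂ) : Prop where
  mem : ∀ p, e p ∈ 𝒜 p
  unit_mul : ∀ p, ∀ a ∈ 𝒜 p, e p * a = a
  mul_unit : ∀ p, ∀ a ∈ 𝒜 p, a * e p = a
  comm : ∀ p q, e p * e q = e q * e p
  map_unit : ∀ i j, φ (e (i, j)) = if i = j then 1 else 0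
  cond_unit : ∀ i j k, ψ j (e (i, k)) = if j = k then 1 else 0

/-- `e` is a matricially free array of units associated with `𝒜` and the array of states defined
by `φ` and `ψ`. -/
structure IsMatriciallyFreeUnits {ι A : Type*} [DecidableEq ι] [Ring A] [Algebra ℂ A]
    (𝒜 : ι × ι → NonUnitalSubalgebra ℂ A) (e : ι × ι → A)
    (φ : A →ₗ[ℂ] ℂ) (ψ : ι → A →ₗ[ℂ] ℂ) : Prop where
  factor : ∀ u₁ ∈ Algebra.adjoin ℂ (Set.range e), ∀ u₂ ∈ Algebra.adjoin ℂ (Set.range e),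
    ∀ a : A, φ (u₁ * a * u₂) = φ u₁ * φ a * φ u₂
  remove : ∀ (a : A) (p : ι × ι) (w : List ((ι × ι) × A)), w ≠ [] →
    (p :: w.map Prod.fst).IsChain (· ≠ ·) → IsCentered 𝒜 φ ψ w →
    p :: w.map Prod.fst ∈ Lam ι →
    φ (a * e p * (w.map Prod.snd).prod) = φ (a * (w.map Prod.snd).prod)
  vanish : ∀ (a : A) (p : ι × ι) (w : List ((ι × ι) × A)), w ≠ [] →
    (p :: w.map Prod.fst).IsChain (· ≠ ·) → IsCentered 𝒜 φ ψ w →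
    p :: w.map Prod.fst ∉ Lam ι →
    φ (a * e p * (w.map Prod.snd).prod) = 0

/-- The array of subalgebras `𝒜` with internal units `e` is matricially free with respect to the
array of states defined by `φ` and `ψ`. -/
structure IsMatriciallyFree {ι A : Type*} [DecidableEq ι] [Ring A] [Algebra ℂ A]
    (𝒜 : ι × ι → NonUnitalSubalgebra ℂ A) (e : ι × ι → A)
    (φ : A →ₗ[ℂ] ℂ) (ψ : ι → A →ₗ[ℂ] ℂ) : Prop where
  internal : HasInternalUnits 𝒜 e φ ψ
  centered : ∀ w : List ((ι × ι) × A), w ≠ [] → (w.map Prod.fst).IsChain (· ≠ ·) →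
    IsCentered 𝒜 φ ψ w → φ (w.map Prod.snd).prod = 0
  units : IsMatriciallyFreeUnits 𝒜 e φ ψ

/-- An array `X` of self-adjoint elements of a unital `*`-algebra is matricially free with respect
to the array of states defined by `φ` and `ψ`: there are projections `e (i, j)` such that the
algebras `ℂ[X i j, e (i, j)]`, with internal units `e (i, j)`, are matricially free. -/
def IsMatriciallyFreeArray {ι A : Type*} [DecidableEq ι] [Ring A] [StarRing A] [Algebra ℂ A]
    (X : ι → ι → A) (φ : A →ₗ[ℂ] ℂ) (ψ : ι → A →ₗ[ℂ] ℂ) : Prop :=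
  (∀ i j, IsSelfAdjoint (X i j)) ∧
  ∃ e : ι × ι → A, (∀ p, IsSelfAdjoint (e p)) ∧
    IsMatriciallyFree (fun p => NonUnitalAlgebra.adjoin ℂ {X p.1 p.2, e p}) e φ ψ

/-- The random pseudomatrix: the sum of all entries of the array. -/
def pseudomatrix {n : ℕ} {A : Type*} [Ring A] (X : Fin n → Fin n → A) : A :=
  ∑ i, ∑ j, X i j

/-- The index `p ∈ {0, …, n-1}` lies in the `k`-th of the consecutive intervals `N₁, …, N_r` of
lengths `⌊(d₁+…+d_k) n⌋ - ⌊(d₁+…+d_{k-1}) n⌋`. -/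
def InBlock {r : ℕ} (d : Fin r → ℝ) (n : ℕ) (k : Fin r) (p : Fin n) : Prop :=
  ⌊(∑ l ∈ Finset.Iio k, d l) * n⌋ ≤ (p : ℤ) ∧ (p : ℤ) < ⌊(∑ l ∈ Finset.Iic k, d l) * n⌋

/-! ## Transforms of probability measures and continued fractions -/

/-- The Cauchy transform. -/
noncomputable def cauchyTransform (μ : Measure ℝ) (z : ℂ) : ℂ := ∫ x : ℝ, (z - (x : ℂ))⁻¹ ∂μ

/-- The K-transform `K_μ(z) = z - 1 / G_μ(z)`. -/
noncomputable def kTransform (μ : Measure ℝ) (z : ℂ) : ℂ := z - (cauchyTransform μ z)⁻¹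

/-- `ν` is the boolean additive convolution of the finite family `μ` of probability measures:
on the upper half-plane its K-transform is the sum of the K-transforms of the `μ j`. -/
def IsBooleanConvolution {ι : Type*} [Fintype ι] (μ : ι → ProbabilityMeasure ℝ)
    (ν : ProbabilityMeasure ℝ) : Prop :=
  ∀ z : ℂ, 0 < z.im → kTransform (ν : Measure ℝ) z = ∑ j, kTransform (μ j : Measure ℝ) z

/-- The `m`-th approximant of the continued fraction `K_{i,j}`:
`b_{i,j} / z` for `m = 0`, and `b_{i,j} / (z - ∑ₚ K_{p,i}^{(m)}(z))` for `m + 1`. -/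
noncomputable def approxK {r : ℕ} (B : Matrix (Fin r) (Fin r) ℝ) :
    ℕ → Fin r → Fin r → ℂ → ℂ
  | 0, i, j, z => (B i j : ℂ) / z
  | m + 1, i, j, z => (B i j : ℂ) / (z - ∑ p, approxK B m p i z)

/-- The continued fraction `K_{i,j}(z)`: the limit of its approximants. -/
noncomputable def fracK {r : ℕ} (B : Matrix (Fin r) (Fin r) ℝ) (i j : Fin r) (z : ℂ) : ℂ :=
  limUnder atTop (fun m => approxK B m i j z)

/-- The measure `ν` represents the `φ`-distribution of `a`, i.e. the functional `f ↦ φ(f(a))` on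
polynomials: `ν` has moments of all orders, and they are the moments `φ(a^m)`. -/
def RepresentsDistribution {A : Type*} [Ring A] [Algebra ℂ A] (φ : A →ₗ[ℂ] ℂ) (a : A)
    (ν : ProbabilityMeasure ℝ) : Prop :=
  ∀ m : ℕ, Integrable (fun x : ℝ => x ^ m) (ν : Measure ℝ) ∧
    ((∫ x : ℝ, x ^ m ∂(ν : Measure ℝ) : ℝ) : ℂ) = φ (a ^ m)

end MatFree

open MatFree

/-! ## The method of moments for compactly supported limits -/

namespace MatFree

/-! The moments of the sum `S` of all entries are computed by letting `S` act on reduced words `w`,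
products of centered powers of entries, inside `φ(S^m w)`. By matricial freeness an entry whose
column does not continue the path of labels of `w` contributes zero, so the words that occur are
encoded by row indices and degrees alone. On such a word `S` either creates a new first letter of
degree one, or meets the first letter itself: it raises its degree, removes it at the cost of a
moment, or resets its degree to one. This closes into a recursion in `m` (`map_sum_cons`,
`WordRecursion`).

A letter of degree `k` has order `n^(-(k+1)/2)` (`exists_word_bound`). After rescaling, only words
of degree-one letters survive: creation turns into an average over blocks with weights `d`, removal
contributes a variance from `U`, and all higher moments disappear (`exists_word_limit`). The
limiting recursion is solved by products of the series `S_k = 1/(1 - X² ∑_p b_{p,k} S_p)`, and the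
limiting moment series is `S_0 = 1/(1 - X² ∑_p b_{p,p} S_p)` (`limitRecursion_wordSeries`).

It remains to realize these formal continued fractions by measures. For finitely supported laws with
Cauchy transforms `G_p` and weights `a_p ≥ 0`, the function `1/(z - ∑ a_p G_p)` is again such a
Cauchy transform: by a Schur complement it is the border entry of the resolvent of an arrowhead
matrix (`exists_spectral_arrowhead`, `exists_branch`). The bound `|G| ≤ 2/R` outside `[-R, R]` is
inherited along with the support, so one radius serves all approximants. Their moments stabilize
because of the factor `X²`, and compactness yields limit laws whose Cauchy transforms are the limits
of the approximants (`exists_branch_limits`). Compact support of the limit law makes the method of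
moments available (`tendsto_of_tendsto_moments`). -/

/-- The measure is concentrated on `[-R, R]`. -/
def ConcentratedOn (R : ℝ) (μ : ProbabilityMeasure ℝ) : Prop :=
  (μ : Measure ℝ) (Set.Icc (-R) R)ᶜ = 0

theorem ConcentratedOn.ae {R : ℝ} {μ : ProbabilityMeasure ℝ} (h : ConcentratedOn R μ) :
    ∀ᵐ x ∂(μ : Measure ℝ), x ∈ Set.Icc (-R) R := by
  rw [ae_iff]; exact h

theorem ConcentratedOn.integrable {R : ℝ} {μ : ProbabilityMeasure ℝ} (h : ConcentratedOn R μ)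
    {f : ℝ → ℝ} (hf : Continuous f) : Integrable f (μ : Measure ℝ) := by
  obtain ⟨C, hC⟩ := isCompact_Icc.exists_bound_of_continuousOn (s := Set.Icc (-R) R) hf.continuousOn
  exact Integrable.of_bound hf.aestronglyMeasurable C (h.ae.mono hC)

theorem ConcentratedOn.radius_nonneg {R : ℝ} {μ : ProbabilityMeasure ℝ}
    (h : ConcentratedOn R μ) : 0 ≤ R := by
  by_contra! hR
  have : Set.Icc (-R) R = ∅ := Set.Icc_eq_empty (by linarith)
  simp [ConcentratedOn, this] at h

/-- The integral against a measure concentrated on `[-R, R]` only depends on the restriction to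
this interval. -/
theorem ConcentratedOn.integral_pow_clamp {R : ℝ} {μ : ProbabilityMeasure ℝ}
    (h : ConcentratedOn R μ) (k : ℕ) :
    ∫ x, (max (-R) (min R x)) ^ k ∂(μ : Measure ℝ) = ∫ x, x ^ k ∂(μ : Measure ℝ) := by
  refine integral_congr_ae (h.ae.mono fun x hx => ?_)
  simp [min_eq_right hx.2, max_eq_right hx.1]

/-- Convergent moment sequences of measures on a fixed interval are realized in the limit. -/
theorem exists_measure_of_tendsto_moments {R : ℝ} (μ : ℕ → ProbabilityMeasure ℝ)
    (h : ∀ n, ConcentratedOn R (μ n)) (t : ℕ → ℝ)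
    (ht : ∀ k, Tendsto (fun n => ∫ x, x ^ k ∂(μ n : Measure ℝ)) atTop (𝓝 (t k))) :
    ∃ ν : ProbabilityMeasure ℝ, ConcentratedOn R ν ∧ ∀ k, ∫ x, x ^ k ∂(ν : Measure ℝ) = t k := by
  -- Prokhorov's theorem with tolerance `0` and one fixed compact set: the tight family is exactly
  -- the set of laws concentrated on `[-R, R]`.
  have hcomp := isCompact_setOfPred_probabilityMeasure_mass_eq_compl_isCompact_le
    (E := ℝ) (u := fun _ => 0) (K := fun _ => Set.Icc (-R) R) tendsto_const_nhds
    (fun _ => isCompact_Icc) (Or.inr monotone_const)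
  have hmem : ∀ ρ : ProbabilityMeasure ℝ,
      (ρ ∈ {ρ : ProbabilityMeasure ℝ | ∀ _ : ℕ, ρ (Set.Icc (-R) R)ᶜ ≤ 0}) ↔
        ConcentratedOn R ρ := by
    intro ρ
    simp [ConcentratedOn, ProbabilityMeasure.null_iff_toMeasure_null]
  -- An ultrafilter limit replaces a convergent subsequence; it suffices because the moments
  -- converge along the full sequence.
  obtain ⟨ν, hν, hlim⟩ := isCompact_iff_ultrafilter_le_nhds.1 hcomp
    ((Ultrafilter.of atTop).map μ) (by
      rw [le_principal_iff, Ultrafilter.mem_coe, Ultrafilter.mem_map]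
      exact Filter.univ_mem' fun k => (hmem (μ k)).2 (h k))
  have hν' := (hmem ν).1 hν
  refine ⟨ν, hν', fun k => ?_⟩
  -- Clamping turns `x ^ k` into a bounded test function without changing any of the integrals
  -- involved.
  have hcont : Continuous fun x : ℝ => (max (-R) (min R x)) ^ k := by fun_prop
  have hR := hν'.radius_nonneg
  let f : BoundedContinuousFunction ℝ ℝ := BoundedContinuousFunction.ofNormedAddCommGroup
    (fun x : ℝ => (max (-R) (min R x)) ^ k) hcont (R ^ k) (fun x => by
      rw [norm_pow, Real.norm_eq_abs]
      refine pow_le_pow_left₀ (abs_nonneg _) (abs_le.2 ⟨le_max_left _ _, ?_⟩) k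
      exact max_le (by linarith) (min_le_left _ _))
  have h1 : Tendsto μ (Ultrafilter.of atTop : Ultrafilter ℕ) (𝓝 ν) := hlim
  have h2 := (ProbabilityMeasure.tendsto_iff_forall_integral_tendsto.1 h1) f
  have h3 : Tendsto (fun n => ∫ x, x ^ k ∂(μ n : Measure ℝ))
      (Ultrafilter.of atTop : Ultrafilter ℕ) (𝓝 (t k)) := (ht k).mono_left (Ultrafilter.of_le _)
  have h4 : (fun n => ∫ x, f x ∂(μ n : Measure ℝ)) = fun n => ∫ x, x ^ k ∂(μ n : Measure ℝ) :=
    funext fun n => (h n).integral_pow_clamp k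
  rw [h4] at h2
  rw [← hν'.integral_pow_clamp k]
  exact tendsto_nhds_unique h2 h3

/-- A polynomial grows at most like a sufficiently high even power. -/
theorem abs_polynomial_eval_le (P : Polynomial ℝ) {ρ : ℝ} (hρ : 0 < ρ) {L : ℕ}
    (hL : P.natDegree ≤ 2 * L) {x : ℝ} (hx : ρ ≤ |x|) :
    |P.eval x| ≤ (∑ i ∈ Finset.range (P.natDegree + 1), |P.coeff i| * ρ ^ i) *
      (x / ρ) ^ (2 * L) := by
  have h1 : 1 ≤ |x| / ρ := (one_le_div hρ).2 hx
  have h2 : (x / ρ) ^ (2 * L) = (|x| / ρ) ^ (2 * L) := by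
    rw [div_pow, div_pow, pow_mul |x|, sq_abs, ← pow_mul]
  rw [Polynomial.eval_eq_sum_range, h2, Finset.sum_mul]
  refine (Finset.abs_sum_le_sum_abs _ _).trans (Finset.sum_le_sum fun i hi => ?_)
  have hi' : i ≤ 2 * L := by
    have := Finset.mem_range.1 hi
    omega
  rw [abs_mul, abs_pow, mul_assoc]
  refine mul_le_mul_of_nonneg_left ?_ (abs_nonneg _)
  calc |x| ^ i = ρ ^ i * (|x| / ρ) ^ i := by rw [div_pow]; field_simp
    _ ≤ _ := by gcongr

theorem integrable_polynomial_eval {μ : Measure ℝ}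
    (hμ : ∀ k : ℕ, Integrable (fun x : ℝ => x ^ k) μ) (P : Polynomial ℝ) :
    Integrable (fun x => P.eval x) μ := by
  simp only [Polynomial.eval_eq_sum_range]
  exact integrable_finsetSum _ fun i _ => (hμ i).const_mul _

theorem integral_polynomial_eval {μ : Measure ℝ}
    (hμ : ∀ k : ℕ, Integrable (fun x : ℝ => x ^ k) μ) (P : Polynomial ℝ) :
    ∫ x, P.eval x ∂μ = ∑ i ∈ Finset.range (P.natDegree + 1), P.coeff i * ∫ x, x ^ i ∂μ := by
  simp only [Polynomial.eval_eq_sum_range]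
  rw [integral_finsetSum _ fun i _ => (hμ i).const_mul _]
  simp only [integral_const_mul]

/-- **Method of moments**: convergence of all moments to those of a compactly supported measure
implies weak convergence. -/
theorem tendsto_of_tendsto_moments {R : ℝ} {μ : ProbabilityMeasure ℝ} (hμ : ConcentratedOn R μ)
    (ν : ℕ → ProbabilityMeasure ℝ)
    (hint : ∀ n k, Integrable (fun x : ℝ => x ^ k) (ν n : Measure ℝ))
    (ht : ∀ k, Tendsto (fun n => ∫ x, x ^ k ∂(ν n : Measure ℝ)) atTop
      (𝓝 (∫ x, x ^ k ∂(μ : Measure ℝ)))) :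
    Tendsto ν atTop (𝓝 μ) := by
  rw [ProbabilityMeasure.tendsto_iff_forall_integral_tendsto]
  intro f
  have hR := hμ.radius_nonneg
  rw [Metric.tendsto_nhds]
  intro δ hδ
  -- Four errors of size at most `ε` occur: two for `ν n` against the polynomial, one for its
  -- moments, one for `μ`.
  set ε := δ / 5 with hε
  have hε0 : 0 < ε := by positivity
  -- The approximation interval is strictly larger than the support, so that `(R / ρ) ^ (2 * L)`
  -- tends to `0`: the even moment of order `2 * L` then controls what `ν n` does outside `[-ρ, ρ]`.
  set ρ := R + 1 with hρ
  have hρ0 : 0 < ρ := by positivity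
  obtain ⟨P, hP⟩ := exists_polynomial_near_of_continuousOn (-ρ) ρ f f.continuous.continuousOn ε hε0
  set C := ‖f‖ + ∑ i ∈ Finset.range (P.natDegree + 1), |P.coeff i| * ρ ^ i with hC
  have hC0 : 0 ≤ C := by positivity
  obtain ⟨L, hLdeg, hL⟩ : ∃ L : ℕ, P.natDegree ≤ 2 * L ∧ C * (R / ρ) ^ (2 * L) < ε := by
    have h0 : Tendsto (fun L : ℕ => C * ((R / ρ) ^ 2) ^ L) atTop (𝓝 (C * 0)) := by
      refine Tendsto.const_mul _ (tendsto_pow_atTop_nhds_zero_of_lt_one (by positivity) ?_)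
      have : R / ρ < 1 := (div_lt_one hρ0).2 (by linarith)
      exact pow_lt_one₀ (by positivity) this two_ne_zero
    rw [mul_zero] at h0
    obtain ⟨L, hL1, hL2⟩ := ((h0.eventually (gt_mem_nhds hε0)).and
      (eventually_ge_atTop P.natDegree)).exists
    exact ⟨L, by omega, by rw [pow_mul]; exact hL1⟩
  have hbound : ∀ x, |f x - P.eval x| ≤ ε + C * (x / ρ) ^ (2 * L) := by
    intro x
    have hpos : 0 ≤ (x / ρ) ^ (2 * L) := by rw [pow_mul]; positivity
    rcases le_or_gt |x| ρ with hx | hx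
    · have := (hP x (abs_le.1 hx)).le
      rw [abs_sub_comm] at this
      have := mul_nonneg hC0 hpos
      linarith
    · have h1 := abs_polynomial_eval_le P hρ0 hLdeg hx.le
      have h2 : |f x| ≤ ‖f‖ := f.norm_coe_le_norm x
      have h3 : 1 ≤ (x / ρ) ^ (2 * L) := by
        rw [pow_mul, div_pow, ← sq_abs x, ← div_pow]
        exact one_le_pow₀ (one_le_pow₀ ((one_le_div hρ0).2 hx.le))
      have h4 : |f x - P.eval x| ≤ |f x| + |P.eval x| := abs_sub _ _
      have h5 : ‖f‖ ≤ ‖f‖ * (x / ρ) ^ (2 * L) := le_mul_of_one_le_right (norm_nonneg _) h3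
      rw [hC, add_mul]
      linarith
  have hPlim : Tendsto (fun n => ∫ x, P.eval x ∂(ν n : Measure ℝ)) atTop
      (𝓝 (∫ x, P.eval x ∂(μ : Measure ℝ))) := by
    rw [integral_polynomial_eval (fun k => hμ.integrable (by fun_prop)) P]
    simp only [fun n => integral_polynomial_eval (hint n) P]
    exact tendsto_finsetSum _ fun i _ => (ht i).const_mul _
  have hfint : ∀ ρ : ProbabilityMeasure ℝ, Integrable f (ρ : Measure ℝ) := fun ρ => f.integrable _
  have hμP : |∫ x, f x ∂(μ : Measure ℝ) - ∫ x, P.eval x ∂(μ : Measure ℝ)| ≤ ε := by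
    rw [← integral_sub (hfint μ) (hμ.integrable P.continuous)]
    have := norm_integral_le_of_norm_le_const (μ := (μ : Measure ℝ))
      (f := fun x => f x - P.eval x) (C := ε) (hμ.ae.mono fun x hx => by
        have := hP x ⟨by linarith [hx.1], by linarith [hx.2]⟩
        rw [abs_sub_comm] at this
        exact this.le)
    simpa using this
  have hνP : ∀ n, |∫ x, f x ∂(ν n : Measure ℝ) - ∫ x, P.eval x ∂(ν n : Measure ℝ)| ≤
      ε + C / ρ ^ (2 * L) * ∫ x, x ^ (2 * L) ∂(ν n : Measure ℝ) := by
    intro n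
    have hPi := integrable_polynomial_eval (hint n) P
    rw [← integral_sub (hfint _) hPi]
    refine (abs_integral_le_integral_abs).trans ?_
    have h1 : Integrable (fun x => C / ρ ^ (2 * L) * x ^ (2 * L)) (ν n : Measure ℝ) :=
      (hint n _).const_mul _
    calc _ ≤ ∫ x, (ε + C / ρ ^ (2 * L) * x ^ (2 * L)) ∂(ν n : Measure ℝ) := by
          refine integral_mono ((hfint _).sub hPi).abs ((integrable_const _).add h1) fun x => ?_
          refine (hbound x).trans (le_of_eq ?_)
          rw [div_pow]; ring
      _ = _ := by
          rw [integral_add (integrable_const _) h1, integral_const_mul]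
          simp
  have hmom : ∫ x, x ^ (2 * L) ∂(μ : Measure ℝ) ≤ R ^ (2 * L) := by
    have := integral_mono_ae (hμ.integrable (f := fun x => x ^ (2 * L)) (by fun_prop))
      (integrable_const (R ^ (2 * L))) (hμ.ae.mono fun x hx => by
        show x ^ (2 * L) ≤ R ^ (2 * L)
        rw [pow_mul, pow_mul]
        exact pow_le_pow_left₀ (sq_nonneg _) (sq_le_sq' hx.1 hx.2) L)
    simpa using this
  have hlim2 : Tendsto (fun n => C / ρ ^ (2 * L) * ∫ x, x ^ (2 * L) ∂(ν n : Measure ℝ)) atTop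
      (𝓝 (C / ρ ^ (2 * L) * ∫ x, x ^ (2 * L) ∂(μ : Measure ℝ))) := (ht _).const_mul _
  have hlt : C / ρ ^ (2 * L) * ∫ x, x ^ (2 * L) ∂(μ : Measure ℝ) < ε := by
    refine lt_of_le_of_lt (mul_le_mul_of_nonneg_left hmom (by positivity)) (lt_of_eq_of_lt ?_ hL)
    rw [div_pow]; ring
  filter_upwards [hlim2.eventually (gt_mem_nhds hlt), Metric.tendsto_nhds.1 hPlim ε hε0]
    with n h1 h2
  rw [Real.dist_eq] at h2 ⊢
  have h3 := hνP n
  have e : ∫ x, f x ∂(ν n : Measure ℝ) - ∫ x, f x ∂(μ : Measure ℝ) =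
    (∫ x, f x ∂(ν n : Measure ℝ) - ∫ x, P.eval x ∂(ν n : Measure ℝ)) +
    (∫ x, P.eval x ∂(ν n : Measure ℝ) - ∫ x, P.eval x ∂(μ : Measure ℝ)) -
    (∫ x, f x ∂(μ : Measure ℝ) - ∫ x, P.eval x ∂(μ : Measure ℝ)) := by ring
  rw [e]
  refine (abs_sub _ _).trans_lt ?_
  have := abs_add_le (∫ x, f x ∂(ν n : Measure ℝ) - ∫ x, P.eval x ∂(ν n : Measure ℝ))
    (∫ x, P.eval x ∂(ν n : Measure ℝ) - ∫ x, P.eval x ∂(μ : Measure ℝ))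
  linarith

/-! ## Finitely supported measures and arrowhead matrices -/

/-- The bordered diagonal matrix with border `√ρ` and diagonal `(0, x)`. -/
noncomputable def arrowhead {ι : Type*} [DecidableEq ι] (ρ x : ι → ℝ) :
    Matrix (Option ι) (Option ι) ℝ
  | none, none => 0
  | none, some i => √(ρ i)
  | some i, none => √(ρ i)
  | some i, some j => if i = j then x i else 0

theorem arrowhead_isHermitian {ι : Type*} [DecidableEq ι] (ρ x : ι → ℝ) :
    (arrowhead ρ x).IsHermitian := by
  ext a b
  rcases a with _ | i <;> rcases b with _ | j <;> simp [Matrix.conjTranspose_apply, arrowhead]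
  by_cases h : i = j
  · simp [h]
  · simp [h, Ne.symm h]

/-- The spectral distribution of an arrowhead matrix at the border vector: its atoms `y` and
weights `w` satisfy the continued-fraction relation in every commutative algebra. -/
theorem exists_spectral_arrowhead {ι : Type} [Fintype ι] [DecidableEq ι] (ρ x : ι → ℝ)
    (hρ : ∀ i, 0 ≤ ρ i) :
    ∃ w y : Option ι → ℝ, (∀ j, 0 ≤ w j) ∧ ∑ j, w j = 1 ∧
      (∀ j, (∃ i, y j = x i) ∨ y j = ∑ i, ρ i / (y j - x i)) ∧
      ∀ {S : Type} [CommRing S] [Algebra ℝ S] (α β : S) (s : ι → S) (q : Option ι → S) (g : S),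
        (∀ i, (α - β * algebraMap ℝ S (x i)) * s i = 1) →
        (∀ j, (α - β * algebraMap ℝ S (y j)) * q j = 1) →
        (α - β ^ 2 * ∑ i, algebraMap ℝ S (ρ i) * s i) * g = 1 →
        ∑ j, algebraMap ℝ S (w j) * q j = g := by
  have hA := arrowhead_isHermitian ρ x
  set u : Option ι → Option ι → ℝ := fun j a => hA.eigenvectorBasis j a with hu
  have heig : ∀ j a, ∑ b, arrowhead ρ x a b * u j b = hA.eigenvalues j * u j a := by
    intro j a
    have := congrFun (hA.mulVec_eigenvectorBasis j) a
    simpa [Matrix.mulVec, dotProduct] using this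
  have hcomp : ∀ a b, ∑ j, u j a * u j b = if a = b then 1 else 0 := by
    intro a b
    have := OrthonormalBasis.sum_inner_mul_inner hA.eigenvectorBasis
      (EuclideanSpace.single a (1 : ℝ)) (EuclideanSpace.single b 1)
    simpa [EuclideanSpace.inner_single_left, EuclideanSpace.inner_single_right, hu, eq_comm,
      Pi.single_apply] using this
  have hnorm : ∀ j, ∑ a, u j a ^ 2 = 1 := by
    intro j
    have h1 : ‖hA.eigenvectorBasis j‖ = 1 := hA.eigenvectorBasis.orthonormal.1 j
    have := EuclideanSpace.real_norm_sq_eq (hA.eigenvectorBasis j)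
    rw [h1] at this
    simpa [hu] using this.symm
  have h_none : ∀ j, ∑ i, √(ρ i) * u j (some i) = hA.eigenvalues j * u j none := by
    intro j
    have := heig j none
    simpa [Fintype.sum_option, arrowhead] using this
  have h_some : ∀ j i, √(ρ i) * u j none + x i * u j (some i) =
      hA.eigenvalues j * u j (some i) := by
    intro j i
    have := heig j (some i)
    simpa [Fintype.sum_option, arrowhead] using this
  refine ⟨fun j => u j none ^ 2, hA.eigenvalues, fun j => sq_nonneg _, ?_, ?_, ?_⟩
  · simpa [sq] using hcomp none none
  · intro j
    by_cases h : ∃ i, hA.eigenvalues j = x i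
    · exact Or.inl h
    refine Or.inr ?_
    have hne : ∀ i, hA.eigenvalues j - x i ≠ 0 := fun i hi => h ⟨i, sub_eq_zero.1 hi⟩
    have hsome : ∀ i, u j (some i) = √(ρ i) * u j none / (hA.eigenvalues j - x i) := by
      intro i
      rw [eq_div_iff (hne i)]
      linear_combination -(h_some j i)
    -- If the border coordinate vanished, so would all others, as the eigenvalue differs from every
    -- `x i`; but the eigenvector has norm one.
    have h0 : u j none ≠ 0 := by
      intro h0
      have := hnorm j
      simp [Fintype.sum_option, h0, hsome] at this
    have h1 := h_none j
    apply mul_right_cancel₀ h0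
    rw [← h1, Finset.sum_mul]
    refine Finset.sum_congr rfl fun i _ => ?_
    rw [hsome i]
    have := Real.mul_self_sqrt (hρ i)
    linear_combination (u j none / (hA.eigenvalues j - x i)) * this
  -- Used with `(α, β) = (t, 1)` in `ℝ`, `(z, 1)` in `ℂ` and `(1, X)` in power series: one
  -- computation gives the bound on the real line, the Cauchy transform and the moment series.
  · intro S _ _ α β s q g hs hq hg
    -- The vector with entries `g` and `β √(ρ i) s i g` is the border column of the inverse of `α -
    -- β A`, `A` the arrowhead matrix. Pairing it with an eigenvector of `A` must give the border
    -- coordinate times `q j`; completeness of the eigenbasis then recovers `g`.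
    have hv : ∀ j, algebraMap ℝ S (u j none) * g +
        ∑ i, algebraMap ℝ S (u j (some i)) * (β * algebraMap ℝ S (√(ρ i)) * s i * g) =
        algebraMap ℝ S (u j none) * q j := by
      intro j
      set V := algebraMap ℝ S (u j none) * g +
        ∑ i, algebraMap ℝ S (u j (some i)) * (β * algebraMap ℝ S (√(ρ i)) * s i * g) with hV
      have key : (α - β * algebraMap ℝ S (hA.eigenvalues j)) * V = algebraMap ℝ S (u j none) := by
        have hmap_none : algebraMap ℝ S (hA.eigenvalues j) * algebraMap ℝ S (u j none) =
            ∑ i, algebraMap ℝ S (√(ρ i)) * algebraMap ℝ S (u j (some i)) := by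
          rw [← map_mul, ← h_none j, map_sum]; simp
        have hmap_some : ∀ i, algebraMap ℝ S (√(ρ i)) * algebraMap ℝ S (u j none) +
            algebraMap ℝ S (x i) * algebraMap ℝ S (u j (some i)) =
            algebraMap ℝ S (hA.eigenvalues j) * algebraMap ℝ S (u j (some i)) := by
          intro i
          rw [← map_mul, ← map_mul, ← map_mul, ← map_add, h_some j i]
        have hsq : ∀ i, algebraMap ℝ S (ρ i) =
            algebraMap ℝ S (√(ρ i)) * algebraMap ℝ S (√(ρ i)) := by
          intro i
          rw [← map_mul, Real.mul_self_sqrt (hρ i)]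
        have e1 : algebraMap ℝ S (u j none) =
            algebraMap ℝ S (u j none) * ((α - β ^ 2 * ∑ i, algebraMap ℝ S (ρ i) * s i) * g) := by
          rw [hg, mul_one]
        rw [e1]
        have e2 : ∀ i, (α - β * algebraMap ℝ S (hA.eigenvalues j)) *
            (algebraMap ℝ S (u j (some i)) * (β * algebraMap ℝ S (√(ρ i)) * s i * g)) =
            β * g * (algebraMap ℝ S (√(ρ i)) * algebraMap ℝ S (u j (some i))) -
            β ^ 2 * g * algebraMap ℝ S (u j none) * (algebraMap ℝ S (ρ i) * s i) := by
          intro i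
          rw [hsq i]
          linear_combination (algebraMap ℝ S (u j (some i)) * β * algebraMap ℝ S (√(ρ i)) * g) *
            hs i + (β ^ 2 * algebraMap ℝ S (√(ρ i)) * s i * g) * hmap_some i
        rw [hV, mul_add, Finset.mul_sum, Finset.sum_congr rfl fun i _ => e2 i,
          Finset.sum_sub_distrib, ← Finset.mul_sum, ← Finset.mul_sum]
        linear_combination -β * g * hmap_none
      calc V = ((α - β * algebraMap ℝ S (hA.eigenvalues j)) * q j) * V := by rw [hq j, one_mul]
        _ = ((α - β * algebraMap ℝ S (hA.eigenvalues j)) * V) * q j := by ring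
        _ = _ := by rw [key]
    have hc : ∀ a b, ∑ j, algebraMap ℝ S (u j a) * algebraMap ℝ S (u j b) =
        if a = b then 1 else 0 := by
      intro a b
      simp only [← map_mul, ← map_sum, hcomp]
      split_ifs <;> simp
    calc ∑ j, algebraMap ℝ S (u j none ^ 2) * q j
        = ∑ j, algebraMap ℝ S (u j none) * (algebraMap ℝ S (u j none) * g +
          ∑ i, algebraMap ℝ S (u j (some i)) * (β * algebraMap ℝ S (√(ρ i)) * s i * g)) := by
          refine Finset.sum_congr rfl fun j _ => ?_
          rw [hv j, map_pow]; ring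
      _ = (∑ j, algebraMap ℝ S (u j none) * algebraMap ℝ S (u j none)) * g +
          ∑ i, (∑ j, algebraMap ℝ S (u j none) * algebraMap ℝ S (u j (some i))) *
            (β * algebraMap ℝ S (√(ρ i)) * s i * g) := by
          simp only [mul_add, Finset.sum_add_distrib, Finset.sum_mul, Finset.mul_sum]
          congr 1
          · exact Finset.sum_congr rfl fun j _ => by ring
          · rw [Finset.sum_comm]
            exact Finset.sum_congr rfl fun i _ => Finset.sum_congr rfl fun j _ => by ring
      _ = g := by simp [hc]

/-- A finitely supported probability distribution on `[-R, R]` whose Cauchy transform is bounded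
by `2 / R` on the real line outside `[-R, R]`. -/
structure FinDist (R : ℝ) where
  κ : Type
  [fintype : Fintype κ]
  w : κ → ℝ
  y : κ → ℝ
  nonneg : ∀ j, 0 ≤ w j
  sum_one : ∑ j, w j = 1
  abs_le : ∀ j, |y j| ≤ R
  bound : ∀ t : ℝ, R < |t| → |∑ j, w j * (t - y j)⁻¹| ≤ 2 / R

attribute [instance] FinDist.fintype

/-! ### Transforms of finitely supported laws and one continued-fraction step -/

namespace FinDist

variable {R : ℝ}

/-- The Cauchy transform. -/
noncomputable def G (ν : FinDist R) (z : ℂ) : ℂ := ∑ j, (ν.w j : ℂ) * (z - ν.y j)⁻¹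

/-- The generating power series of the moments. -/
noncomputable def M (ν : FinDist R) : PowerSeries ℝ :=
  ∑ j, PowerSeries.C (ν.w j) * PowerSeries.mk fun k => ν.y j ^ k

theorem coeff_M (ν : FinDist R) (k : ℕ) :
    PowerSeries.coeff k ν.M = ∑ j, ν.w j * ν.y j ^ k := by
  simp [M, PowerSeries.coeff_C_mul, map_sum]

/-- The associated probability measure. -/
noncomputable def toMeasure (ν : FinDist R) : ProbabilityMeasure ℝ :=
  ⟨∑ j, ENNReal.ofReal (ν.w j) • Measure.dirac (ν.y j), ⟨by
    simp only [Measure.coe_finsetSum, Finset.sum_apply, Measure.smul_apply, measure_univ,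
      smul_eq_mul, mul_one]
    rw [← ENNReal.ofReal_sum_of_nonneg fun j _ => ν.nonneg j, ν.sum_one, ENNReal.ofReal_one]⟩⟩

theorem integral_toMeasure {E : Type*} [NormedAddCommGroup E] [NormedSpace ℝ E] [CompleteSpace E]
    (ν : FinDist R) (f : ℝ → E) :
    ∫ x, f x ∂(ν.toMeasure : Measure ℝ) = ∑ j, ν.w j • f (ν.y j) := by
  have : (ν.toMeasure : Measure ℝ) = ∑ j, ENNReal.ofReal (ν.w j) • Measure.dirac (ν.y j) := rfl
  rw [this, integral_finsetSum_measure]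
  · refine Finset.sum_congr rfl fun j _ => ?_
    rw [integral_smul_measure, integral_dirac, ENNReal.toReal_ofReal (ν.nonneg j)]
  · intro j _
    exact (integrable_dirac (by simp)).smul_measure ENNReal.ofReal_ne_top

theorem concentratedOn_toMeasure (ν : FinDist R) : ConcentratedOn R ν.toMeasure := by
  have : (ν.toMeasure : Measure ℝ) = ∑ j, ENNReal.ofReal (ν.w j) • Measure.dirac (ν.y j) := rfl
  rw [ConcentratedOn, this]
  simp only [Measure.coe_finsetSum, Finset.sum_apply, Measure.smul_apply, smul_eq_mul]
  refine Finset.sum_eq_zero fun j _ => ?_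
  have h : ν.y j ∈ Set.Icc (-R) R := _root_.abs_le.1 (ν.abs_le j)
  simp [Measure.dirac_apply' _ measurableSet_Icc.compl, h]

theorem integral_pow_toMeasure (ν : FinDist R) (k : ℕ) :
    ∫ x, x ^ k ∂(ν.toMeasure : Measure ℝ) = PowerSeries.coeff k ν.M := by
  rw [integral_toMeasure, coeff_M]; rfl

theorem cauchyTransform_toMeasure (ν : FinDist R) (z : ℂ) :
    cauchyTransform (ν.toMeasure : Measure ℝ) z = ν.G z := by
  rw [cauchyTransform, integral_toMeasure, G]
  exact Finset.sum_congr rfl fun j _ => by rw [Complex.real_smul]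

/-- The point mass at the origin. -/
noncomputable def zero (hR : 0 < R) : FinDist R where
  κ := Unit
  w _ := 1
  y _ := 0
  nonneg _ := zero_le_one
  sum_one := by simp
  abs_le _ := by simpa using hR.le
  bound t ht := by
    simp only [Finset.univ_unique, Finset.sum_const, Finset.card_singleton, sub_zero, one_mul,
      one_smul, abs_inv]
    calc |t|⁻¹ ≤ R⁻¹ := by gcongr
      _ ≤ 2 / R := by rw [inv_eq_one_div]; gcongr; norm_num

theorem G_zero (hR : 0 < R) (z : ℂ) : (zero hR).G z = z⁻¹ := by
  show ∑ j : Unit, ((1 : ℝ) : ℂ) * (z - ((0 : ℝ) : ℂ))⁻¹ = _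
  simp

theorem im_G_nonpos (ν : FinDist R) {z : ℂ} (hz : 0 < z.im) : (ν.G z).im ≤ 0 := by
  rw [G, Complex.im_sum]
  refine Finset.sum_nonpos fun j _ => ?_
  rw [Complex.im_ofReal_mul, Complex.inv_im]
  refine mul_nonpos_of_nonneg_of_nonpos (ν.nonneg j) ?_
  exact div_nonpos_of_nonpos_of_nonneg (by simpa using hz.le) (Complex.normSq_nonneg _)

/-- Cauchy transforms map the upper half-plane to the closed lower one, so the imaginary part of the
denominator is at least that of `z`. -/
theorem sub_sum_G_ne_zero {ι : Type*} [Fintype ι] (a : ι → ℝ) (ha : ∀ p, 0 ≤ a p)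
    (ν : ι → FinDist R) {z : ℂ} (hz : 0 < z.im) : z - ∑ p, (a p : ℂ) * (ν p).G z ≠ 0 := by
  intro h
  have h1 := congrArg Complex.im h
  have h2 : (∑ p, (a p : ℂ) * (ν p).G z).im ≤ 0 := by
    rw [Complex.im_sum]
    refine Finset.sum_nonpos fun p _ => ?_
    rw [Complex.im_ofReal_mul]
    exact mul_nonpos_of_nonneg_of_nonpos (ha p) ((ν p).im_G_nonpos hz)
  rw [Complex.sub_im, Complex.zero_im] at h1
  linarith

theorem one_sub_mul_mk_pow (y : ℝ) :
    (1 - PowerSeries.X * PowerSeries.C y) * PowerSeries.mk (fun k => y ^ k) =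
      (1 : PowerSeries ℝ) := by
  ext k
  rw [sub_mul, one_mul, map_sub, mul_assoc, PowerSeries.coeff_mk]
  rcases k with _ | k
  · simp
  · rw [PowerSeries.coeff_succ_X_mul, PowerSeries.coeff_C_mul, PowerSeries.coeff_mk,
      PowerSeries.coeff_one]
    simp [pow_succ']

/-- One step of a continued fraction with several branches. -/
theorem exists_branch (hR : 0 < R) {ι : Type} [Fintype ι] (a : ι → ℝ) (ha : ∀ p, 0 ≤ a p)
    (hsum : ∑ p, a p ≤ (R / 2) ^ 2) (ν : ι → FinDist R) :
    ∃ η : FinDist R,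
      (∀ z : ℂ, 0 < z.im → η.G z = (z - ∑ p, (a p : ℂ) * (ν p).G z)⁻¹) ∧
      (1 - PowerSeries.X ^ 2 * ∑ p, PowerSeries.C (a p) * (ν p).M) * η.M = 1 := by
  classical
  -- A single arrowhead matrix carries the atoms of all branches at once, those of branch `p` with
  -- weights multiplied by `a p`.
  obtain ⟨w, y, hw, hw1, hy, hres⟩ := exists_spectral_arrowhead
    (fun i : Σ p, (ν p).κ => a i.1 * (ν i.1).w i.2) (fun i => (ν i.1).y i.2)
    (fun i => mul_nonneg (ha _) ((ν i.1).nonneg _))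
  have hsig : ∀ {S : Type} [CommRing S] [Algebra ℝ S] (s : (Σ p, (ν p).κ) → S),
      ∑ i : Σ p, (ν p).κ, algebraMap ℝ S (a i.1 * (ν i.1).w i.2) * s i =
        ∑ p, algebraMap ℝ S (a p) * ∑ j, algebraMap ℝ S ((ν p).w j) * s ⟨p, j⟩ := by
    intro S _ _ s
    rw [Fintype.sum_sigma]
    refine Finset.sum_congr rfl fun p _ => ?_
    rw [Finset.mul_sum]
    exact Finset.sum_congr rfl fun j _ => by rw [map_mul, mul_assoc]
  have hreal : ∀ t : ℝ, R < |t| →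
      |∑ p, a p * ∑ j, (ν p).w j * (t - (ν p).y j)⁻¹| ≤ R / 2 := by
    intro t ht
    calc _ ≤ ∑ p, a p * (2 / R) := by
          refine (Finset.abs_sum_le_sum_abs _ _).trans (Finset.sum_le_sum fun p _ => ?_)
          rw [abs_mul, abs_of_nonneg (ha p)]
          exact mul_le_mul_of_nonneg_left ((ν p).bound t ht) (ha p)
      _ ≤ (R / 2) ^ 2 * (2 / R) := by rw [← Finset.sum_mul]; gcongr
      _ = R / 2 := by field_simp
  -- A new atom outside `[-R, R]` would equal the branch sum at that point, whose modulus is at most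
  -- `R / 2`.
  have hyR : ∀ j, |y j| ≤ R := by
    intro j
    by_contra! hj
    rcases hy j with ⟨i, hi⟩ | hi
    · exact absurd (hi ▸ (ν i.1).abs_le i.2) (not_le.2 hj)
    · have h1 := hreal (y j) hj
      have h2 := hsig (S := ℝ) fun i => (y j - (ν i.1).y i.2)⁻¹
      simp only [Algebra.algebraMap_self, RingHom.id_apply] at h2
      simp only [div_eq_mul_inv] at hi
      rw [h2] at hi
      rw [← hi] at h1
      linarith
  have hbound : ∀ t : ℝ, R < |t| → |∑ j, w j * (t - y j)⁻¹| ≤ 2 / R := by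
    intro t ht
    have hne : ∀ v, |v| ≤ R → t - v ≠ 0 := fun v hv h => by
      rw [sub_eq_zero] at h
      rw [h] at ht
      linarith
    have h1 := hreal t ht
    set σ := ∑ p, a p * ∑ j, (ν p).w j * (t - (ν p).y j)⁻¹ with hσ
    -- Here `|t| > R` and `|σ| ≤ R / 2`; inverting reproduces the bound `2 / R`, which closes the
    -- induction.
    have h2 : R / 2 ≤ |t - σ| := by
      have := abs_sub_abs_le_abs_sub t σ
      linarith
    have h3 : t - σ ≠ 0 := fun h => by rw [h, abs_zero] at h2; linarith
    have := hres (S := ℝ) t 1 (fun i => (t - (ν i.1).y i.2)⁻¹) (fun j => (t - y j)⁻¹) (t - σ)⁻¹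
      (fun i => by
        rw [Algebra.algebraMap_self, RingHom.id_apply, one_mul]
        exact mul_inv_cancel₀ (hne _ ((ν i.1).abs_le _)))
      (fun j => by
        rw [Algebra.algebraMap_self, RingHom.id_apply, one_mul]
        exact mul_inv_cancel₀ (hne _ (hyR j)))
      (by
        rw [hsig]
        simp only [Algebra.algebraMap_self, RingHom.id_apply, one_pow, one_mul]
        exact mul_inv_cancel₀ h3)
    simp only [Algebra.algebraMap_self, RingHom.id_apply] at this
    rw [this, abs_inv]
    calc |t - σ|⁻¹ ≤ (R / 2)⁻¹ := by gcongr
      _ = 2 / R := by rw [inv_div]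
  refine ⟨⟨_, w, y, hw, hw1, hyR, hbound⟩, fun z hz => ?_, ?_⟩
  · have hne : ∀ v : ℝ, z - v ≠ 0 := fun v h => by
      have := congrArg Complex.im h
      simp at this
      exact hz.ne' this
    have hne2 := sub_sum_G_ne_zero a ha ν hz
    exact hres (S := ℂ) z 1 (fun i => (z - (ν i.1).y i.2)⁻¹) (fun j => (z - y j)⁻¹) _
      (fun i => by rw [one_mul]; exact mul_inv_cancel₀ (hne _))
      (fun j => by rw [one_mul]; exact mul_inv_cancel₀ (hne _))
      (by
        rw [hsig, one_pow, one_mul]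
        exact mul_inv_cancel₀ hne2)
  · have hone : PowerSeries.constantCoeff (1 - PowerSeries.X ^ 2 *
        ∑ p, PowerSeries.C (a p) * (ν p).M) ≠ (0 : ℝ) := by
      simp
    have := hres (S := PowerSeries ℝ) 1 PowerSeries.X
      (fun i => PowerSeries.mk fun k => (ν i.1).y i.2 ^ k)
      (fun j => PowerSeries.mk fun k => y j ^ k) _
      (fun i => one_sub_mul_mk_pow _) (fun j => one_sub_mul_mk_pow _)
      (by
        rw [hsig]
        exact PowerSeries.mul_inv_cancel _ hone)
    have h2 : FinDist.M ⟨_, w, y, hw, hw1, hyR, hbound⟩ = _ := this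
    rw [h2]
    exact PowerSeries.mul_inv_cancel _ hone

end FinDist

/-! ## Limits of multi-branch continued fractions -/

theorem norm_inv_sub_ofReal_le {z : ℂ} (hz : 0 < z.im) (x : ℝ) : ‖(z - x)⁻¹‖ ≤ z.im⁻¹ := by
  rw [norm_inv]
  have : z.im ≤ ‖z - x‖ := by
    have := Complex.abs_im_le_norm (z - x)
    rw [Complex.sub_im, Complex.ofReal_im, sub_zero] at this
    exact (le_abs_self _).trans this
  gcongr

theorem sub_ofReal_ne_zero {z : ℂ} (hz : 0 < z.im) (x : ℝ) : z - x ≠ 0 := fun h => by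
  have := congrArg Complex.im h
  simp at this
  exact hz.ne' this

/-- For fixed `z` off the real line the Cauchy kernel is a bounded continuous test function. -/
theorem tendsto_cauchyTransform {μ : ℕ → ProbabilityMeasure ℝ} {ν : ProbabilityMeasure ℝ}
    (h : Tendsto μ atTop (𝓝 ν)) {z : ℂ} (hz : 0 < z.im) :
    Tendsto (fun n => cauchyTransform (μ n : Measure ℝ) z) atTop
      (𝓝 (cauchyTransform (ν : Measure ℝ) z)) := by
  have hcont : Continuous fun x : ℝ => (z - (x : ℂ))⁻¹ :=
    (continuous_const.sub Complex.continuous_ofReal).inv₀ (sub_ofReal_ne_zero hz)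
  exact (ProbabilityMeasure.tendsto_iff_forall_integral_rclike_tendsto ℂ).1 h
    (BoundedContinuousFunction.ofNormedAddCommGroup _ hcont _ (norm_inv_sub_ofReal_le hz))

/-- Pointwise convergence of locally equi-Lipschitz functions is locally uniform. -/
theorem tendstoLocallyUniformlyOn_of_lipschitz {U : Set ℂ} {F : ℕ → ℂ → ℂ} {f : ℂ → ℂ}
    (hlim : ∀ z ∈ U, Tendsto (fun m => F m z) atTop (𝓝 (f z)))
    (hlip : ∀ z ∈ U, ∃ V ∈ 𝓝[U] z, ∃ L : ℝ, 0 ≤ L ∧ V ⊆ U ∧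
      ∀ m, ∀ y ∈ V, ‖F m y - F m z‖ ≤ L * ‖y - z‖) :
    TendstoLocallyUniformlyOn F f atTop U := by
  rw [Metric.tendstoLocallyUniformlyOn_iff]
  intro ε hε z hz
  obtain ⟨V, hV, L, hL, hVU, hF⟩ := hlip z hz
  have hball : Metric.ball z (ε / (4 * (L + 1))) ∈ 𝓝[U] z :=
    mem_nhdsWithin_of_mem_nhds (Metric.ball_mem_nhds z (by positivity))
  refine ⟨V ∩ Metric.ball z (ε / (4 * (L + 1))), inter_mem hV hball, ?_⟩
  filter_upwards [Metric.tendsto_nhds.1 (hlim z hz) (ε / 2) (by positivity)] with n hn y hy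
  have hlimLip : ‖f y - f z‖ ≤ L * ‖y - z‖ :=
    le_of_tendsto ((hlim y (hVU hy.1)).sub (hlim z hz)).norm
      (Eventually.of_forall fun m => hF m y hy.1)
  have h1 := hF n y hy.1
  have h2 : ‖y - z‖ < ε / (4 * (L + 1)) := by simpa [dist_eq_norm] using hy.2
  have h3 : L * ‖y - z‖ ≤ ε / 4 := by
    calc L * ‖y - z‖ ≤ (L + 1) * (ε / (4 * (L + 1))) := by gcongr; linarith
      _ = ε / 4 := by field_simp
  rw [dist_eq_norm] at hn ⊢
  calc ‖f y - F n y‖ = ‖(f y - f z) - (F n y - F n z) - (F n z - f z)‖ := by congr 1; ring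
    _ ≤ ‖f y - f z‖ + ‖F n y - F n z‖ + ‖F n z - f z‖ :=
      (norm_sub_le _ _).trans (by gcongr; exact norm_sub_le _ _)
    _ < ε := by linarith

namespace FinDist

variable {R : ℝ}

/-- By the resolvent identity the Lipschitz constant depends only on the distance to the real line,
not on the law; this upgrades pointwise convergence to locally uniform convergence. -/
theorem norm_G_sub_le (ν : FinDist R) {δ : ℝ} (hδ : 0 < δ) {y z : ℂ} (hy : δ ≤ y.im)
    (hz : δ ≤ z.im) : ‖ν.G y - ν.G z‖ ≤ (δ⁻¹ * δ⁻¹) * ‖y - z‖ := by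
  have hb : ∀ {v : ℂ}, δ ≤ v.im → ∀ x : ℝ, ‖(v - x)⁻¹‖ ≤ δ⁻¹ := fun hv x =>
    (norm_inv_sub_ofReal_le (hδ.trans_le hv) x).trans (by gcongr)
  rw [G, G, ← Finset.sum_sub_distrib]
  refine (norm_sum_le _ _).trans ?_
  calc _ ≤ ∑ j, ν.w j * ((δ⁻¹ * δ⁻¹) * ‖y - z‖) := by
        refine Finset.sum_le_sum fun j _ => ?_
        rw [← mul_sub, norm_mul, Complex.norm_real, Real.norm_of_nonneg (ν.nonneg j)]
        refine mul_le_mul_of_nonneg_left ?_ (ν.nonneg j)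
        have e : (y - ν.y j)⁻¹ - (z - ν.y j)⁻¹ =
            (y - ν.y j)⁻¹ * (z - ν.y j)⁻¹ * (z - y) := by
          have h1 := sub_ofReal_ne_zero (hδ.trans_le hy) (ν.y j)
          have h2 := sub_ofReal_ne_zero (hδ.trans_le hz) (ν.y j)
          field_simp
          ring
        rw [e, norm_mul, norm_mul, norm_sub_rev z y]
        gcongr
        · exact hb hy _
        · exact hb hz _
    _ = _ := by rw [← Finset.sum_mul, ν.sum_one, one_mul]

/-- Finitely supported distributions whose moments converge have a limit. -/
theorem exists_limit (ν : ℕ → FinDist R) (t : ℕ → ℝ)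
    (ht : ∀ k, Tendsto (fun n => PowerSeries.coeff k (ν n).M) atTop (𝓝 (t k))) :
    ∃ μ : ProbabilityMeasure ℝ, ConcentratedOn R μ ∧ (∀ k, ∫ x, x ^ k ∂(μ : Measure ℝ) = t k) ∧
      ∀ z : ℂ, 0 < z.im →
        Tendsto (fun n => (ν n).G z) atTop (𝓝 (cauchyTransform (μ : Measure ℝ) z)) := by
  simp only [← integral_pow_toMeasure] at ht
  obtain ⟨μ, hμ, hmom⟩ := exists_measure_of_tendsto_moments (fun n => (ν n).toMeasure)
    (fun n => (ν n).concentratedOn_toMeasure) t ht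
  refine ⟨μ, hμ, hmom, fun z hz => ?_⟩
  simp only [← cauchyTransform_toMeasure]
  refine tendsto_cauchyTransform (tendsto_of_tendsto_moments hμ _
    (fun n k => (ν n).concentratedOn_toMeasure.integrable (by fun_prop)) fun k => ?_) hz
  rw [hmom k]
  exact ht k

end FinDist

/-! ### X-adic convergence of formal continued fractions -/

section PowerSeries

open PowerSeries

/-- The denominator series `1 - X² ∑ₚ aₚ Sₚ`. -/
noncomputable def branchDen {ι : Type*} [Fintype ι] (a : ι → ℝ) (S : ι → PowerSeries ℝ) :
    PowerSeries ℝ :=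
  1 - X ^ 2 * ∑ p, C (a p) * S p

/-- The identity `S - S' = -(D - D') S S'` shows that inversion preserves X-adic closeness. -/
theorem dvd_sub_of_mul_eq_one {D D' S S' : PowerSeries ℝ} (h : D * S = 1) (h' : D' * S' = 1)
    {P : PowerSeries ℝ} (hP : P ∣ D - D') : P ∣ S - S' := by
  have : S - S' = -(D - D') * (S * S') := by linear_combination S' * h - S * h'
  rw [this]
  exact Dvd.dvd.mul_right ((dvd_neg).2 hP) _

/-- The factor `X²` makes the continued-fraction step an X-adic contraction; one of the two gained
powers is enough. -/
theorem X_pow_dvd_branchDen_sub {ι : Type*} [Fintype ι] (a : ι → ℝ) {S S' : ι → PowerSeries ℝ}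
    {m : ℕ} (h : ∀ p, X ^ m ∣ S p - S' p) :
    (X : PowerSeries ℝ) ^ (m + 1) ∣ branchDen a S - branchDen a S' := by
  have : branchDen a S - branchDen a S' = X ^ 2 * ∑ p, C (a p) * (S' p - S p) := by
    simp only [branchDen, mul_sub, Finset.sum_sub_distrib]
    ring
  rw [this, pow_succ, mul_comm (X ^ m), show (X : PowerSeries ℝ) ^ 2 = X * X from sq X, mul_assoc]
  refine mul_dvd_mul_left _ (Dvd.dvd.mul_left (Finset.dvd_sum fun p _ => ?_) _)
  exact Dvd.dvd.mul_left ((dvd_sub_comm).1 (h p)) _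

theorem tendsto_coeff_of_X_pow_dvd {S : ℕ → PowerSeries ℝ} {T : PowerSeries ℝ}
    (h : ∀ m, X ^ m ∣ S m - T) (k : ℕ) :
    Tendsto (fun m => coeff k (S m)) atTop (𝓝 (coeff k T)) := by
  refine tendsto_const_nhds.congr' ?_
  filter_upwards [eventually_gt_atTop k] with m hm
  have := PowerSeries.X_pow_dvd_iff.1 (h m) k hm
  rw [map_sub, sub_eq_zero] at this
  exact this.symm

theorem exists_limit_of_X_pow_dvd {S : ℕ → PowerSeries ℝ}
    (h : ∀ m, X ^ m ∣ S (m + 1) - S m) : ∃ T : PowerSeries ℝ, ∀ m, X ^ m ∣ S m - T := by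
  have h2 : ∀ m n, X ^ m ∣ S (m + n) - S m := by
    intro m n
    induction n with
    | zero => simp
    | succ n ih =>
      have h1 := (pow_dvd_pow (X : PowerSeries ℝ) (Nat.le_add_right m n)).trans (h (m + n))
      have := dvd_add h1 ih
      rwa [sub_add_sub_cancel, add_assoc] at this
  -- Coefficient `k` is frozen only from index `k + 1` on, since divisibility by `X ^ k` controls
  -- just the coefficients below `k`.
  refine ⟨PowerSeries.mk fun k => coeff k (S (k + 1)), fun m => ?_⟩
  rw [PowerSeries.X_pow_dvd_iff]
  intro k hk
  have := PowerSeries.X_pow_dvd_iff.1 (h2 (k + 1) (m - (k + 1))) k (by omega)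
  rw [show k + 1 + (m - (k + 1)) = m by omega] at this
  rw [map_sub, coeff_mk]
  rwa [map_sub] at this

theorem eq_of_X_pow_dvd {S T : PowerSeries ℝ} (h : ∀ m, X ^ m ∣ S - T) : S = T := by
  ext k
  have := PowerSeries.X_pow_dvd_iff.1 (h (k + 1)) k (by omega)
  rwa [map_sub, sub_eq_zero] at this

theorem exists_branchDen_mul_eq_one {ι : Type*} [Fintype ι] (a : ι → ℝ)
    (S : ι → PowerSeries ℝ) : ∃ T, branchDen a S * T = 1 :=
  ⟨_, PowerSeries.mul_inv_cancel _ (by simp [branchDen])⟩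

end PowerSeries

/-- The continued fractions with nonnegative coefficients `B`: limits `g` of the approximants on
the upper half-plane, generating series `S` of the moments, and representing measures of all
one-step continuations. -/
theorem exists_branch_limits {r : ℕ} (B : Matrix (Fin r) (Fin r) ℝ) (hB : ∀ i j, 0 ≤ B i j) :
    ∃ (R : ℝ) (S : Fin r → PowerSeries ℝ) (g : Fin r → ℂ → ℂ),
      (∀ i, branchDen (fun p => B p i) S * S i = 1) ∧
      (∀ i j, TendstoLocallyUniformlyOn (fun m => approxK B m i j) (fun z => B i j * g i z)
        atTop {z : ℂ | 0 < z.im}) ∧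
      ∀ a : Fin r → ℝ, (∀ p, 0 ≤ a p) → ∑ p, a p ≤ ∑ i, ∑ j, B i j →
        ∃ μ : ProbabilityMeasure ℝ, ConcentratedOn R μ ∧
          (∀ T, branchDen a S * T = 1 →
            ∀ k, ∫ x, x ^ k ∂(μ : Measure ℝ) = PowerSeries.coeff k T) ∧
          ∀ z : ℂ, 0 < z.im →
            cauchyTransform (μ : Measure ℝ) z = (z - ∑ p, (a p : ℂ) * g p z)⁻¹ := by
  set b := ∑ i, ∑ j, B i j with hb
  have hb0 : 0 ≤ b := Finset.sum_nonneg fun i _ => Finset.sum_nonneg fun j _ => hB i j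
  -- Then `(R / 2) ^ 2 = b + 1 ≥ b`, and the summand `1` keeps `R` positive even for `B = 0`.
  set R := 2 * √(b + 1) with hRdef
  have hR : 0 < R := by positivity
  have hRb : b ≤ (R / 2) ^ 2 := by
    rw [hRdef, mul_div_cancel_left₀ _ two_ne_zero, Real.sq_sqrt (by linarith)]
    linarith
  have hcol : ∀ i, ∑ p, B p i ≤ b := by
    intro i
    have hb' : b = ∑ j, ∑ i, B i j := Finset.sum_comm
    rw [hb']
    exact Finset.single_le_sum (f := fun j => ∑ p, B p j)
      (fun i _ => Finset.sum_nonneg fun p _ => hB p i) (Finset.mem_univ i)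
  choose next hnextG hnextM using fun (a : {a : Fin r → ℝ // (∀ p, 0 ≤ a p) ∧ ∑ p, a p ≤ b})
    (ν : Fin r → FinDist R) => FinDist.exists_branch hR a.1 a.2.1 (a.2.2.trans hRb) ν
  let col : Fin r → {a : Fin r → ℝ // (∀ p, 0 ≤ a p) ∧ ∑ p, a p ≤ b} := fun i =>
    ⟨fun p => B p i, fun p => hB p i, hcol i⟩
  -- Starting from the point mass at `0`, with Cauchy transform `1 / z`, matches the approximant of
  -- order zero.
  let ν : ℕ → Fin r → FinDist R := fun m =>
    Nat.rec (fun _ => FinDist.zero hR) (fun _ ν i => next (col i) ν) m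
  have hν0 : ∀ i, ν 0 i = FinDist.zero hR := fun _ => rfl
  have hνs : ∀ m i, ν (m + 1) i = next (col i) (ν m) := fun _ _ => rfl
  have happrox : ∀ m i j (z : ℂ), 0 < z.im → approxK B m i j z = B i j * (ν m i).G z := by
    intro m
    induction m with
    | zero => intro i j z _; rw [approxK, hν0, FinDist.G_zero, div_eq_mul_inv]
    | succ m ih =>
      intro i j z hz
      rw [approxK, hνs, hnextG _ _ z hz, div_eq_mul_inv]
      congr 3
      exact Finset.sum_congr rfl fun p _ => ih p i z hz
  have hdvd : ∀ m i, PowerSeries.X ^ m ∣ (ν (m + 1) i).M - (ν m i).M := by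
    intro m
    induction m with
    | zero => intro i; simp
    | succ m ih =>
      intro i
      exact dvd_sub_of_mul_eq_one (hnextM (col i) (ν (m + 1))) (hnextM (col i) (ν m))
        (X_pow_dvd_branchDen_sub _ ih)
  choose S hS using fun i => exists_limit_of_X_pow_dvd (S := fun m => (ν m i).M) fun m => hdvd m i
  have hlimbranch : ∀ (a : {a : Fin r → ℝ // (∀ p, 0 ≤ a p) ∧ ∑ p, a p ≤ b}) T,
      branchDen a.1 S * T = 1 → ∀ m, PowerSeries.X ^ (m + 1) ∣ (next a (ν m)).M - T :=
    fun a T hT m => dvd_sub_of_mul_eq_one (hnextM a (ν m)) hT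
      (X_pow_dvd_branchDen_sub _ fun p => hS p m)
  -- The limit is a fixed point: `S i` and the inverse of the limiting denominator are both X-adic
  -- limits of the series of `ν (m + 1) i`.
  have hSeq : ∀ i, branchDen (fun p => B p i) S * S i = 1 := by
    intro i
    obtain ⟨T, hT⟩ := exists_branchDen_mul_eq_one (fun p => B p i) S
    have : S i = T := eq_of_X_pow_dvd fun m => by
      have h1 := (pow_dvd_pow _ (Nat.le_succ m)).trans (hS i (m + 1))
      have h2 := (pow_dvd_pow _ (Nat.le_succ m)).trans (hlimbranch (col i) T hT m)
      have := dvd_sub h2 h1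
      rwa [hνs, sub_sub_sub_cancel_left] at this
    rw [this, hT]
  choose μ hμR hμmom hμG using fun i => FinDist.exists_limit (fun m => ν m i) _
    (tendsto_coeff_of_X_pow_dvd (hS i))
  refine ⟨R, S, fun i z => cauchyTransform (μ i : Measure ℝ) z, hSeq, fun i j => ?_,
    fun a ha hab => ?_⟩
  · have hopen : IsOpen {z : ℂ | 0 < z.im} := isOpen_lt continuous_const Complex.continuous_im
    refine tendstoLocallyUniformlyOn_of_lipschitz (fun z hz => ?_) fun z hz => ?_
    · simp only [fun m => happrox m i j z hz]
      exact (hμG i z hz).const_mul _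
    · have hz' : 0 < z.im := hz
      refine ⟨{y | z.im / 2 < y.im}, mem_nhdsWithin_of_mem_nhds ?_,
        B i j * ((z.im / 2)⁻¹ * (z.im / 2)⁻¹), ?_, fun y hy => ?_, fun m y hy => ?_⟩
      · exact (isOpen_lt continuous_const Complex.continuous_im).mem_nhds (half_lt_self hz')
      · have := hB i j
        positivity
      · exact (half_pos hz').trans hy
      · have hy' : z.im / 2 < y.im := hy
        rw [happrox m i j z hz, happrox m i j y ((half_pos hz').trans hy'), ← mul_sub, norm_mul,
          Complex.norm_real, Real.norm_of_nonneg (hB i j), mul_assoc]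
        exact mul_le_mul_of_nonneg_left
          ((ν m i).norm_G_sub_le (half_pos hz') hy'.le (half_le_self hz'.le)) (hB i j)
  · obtain ⟨T, hT⟩ := exists_branchDen_mul_eq_one a S
    obtain ⟨η, hηR, hηmom, hηG⟩ := FinDist.exists_limit (fun m => next ⟨a, ha, hab⟩ (ν m)) _
      (tendsto_coeff_of_X_pow_dvd fun m => (pow_dvd_pow _ (Nat.le_succ m)).trans
        (hlimbranch ⟨a, ha, hab⟩ T hT m))
    refine ⟨η, hηR, fun T' hT' k => ?_, fun z hz => ?_⟩
    · have : T' = T := by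
        calc T' = (branchDen a S * T) * T' := by rw [hT, one_mul]
          _ = (branchDen a S * T') * T := by ring
          _ = T := by rw [hT', one_mul]
      rw [hηmom, this]
    · refine tendsto_nhds_unique (hηG z hz) ?_
      simp only [fun m => hnextG ⟨a, ha, hab⟩ (ν m) z hz]
      have hden : Tendsto (fun m => z - ∑ p, (a p : ℂ) * (ν m p).G z) atTop
          (𝓝 (z - ∑ p, (a p : ℂ) * cauchyTransform (μ p : Measure ℝ) z)) :=
        tendsto_const_nhds.sub (tendsto_finsetSum _ fun p _ => (hμG p z hz).const_mul _)
      refine hden.inv₀ fun h => ?_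
      have h1 : ∀ p, (cauchyTransform (μ p : Measure ℝ) z).im ≤ 0 := fun p =>
        le_of_tendsto ((Complex.continuous_im.tendsto _).comp (hμG p z hz))
          (Eventually.of_forall fun m => (ν m p).im_G_nonpos hz)
      have h2 := congrArg Complex.im h
      have h3 : (∑ p, (a p : ℂ) * cauchyTransform (μ p : Measure ℝ) z).im ≤ 0 := by
        rw [Complex.im_sum]
        refine Finset.sum_nonpos fun p _ => ?_
        rw [Complex.im_ofReal_mul]
        exact mul_nonpos_of_nonneg_of_nonpos (ha p) (h1 p)
      rw [Complex.sub_im, Complex.zero_im] at h2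
      linarith

/-! ## Reduced words in a matricially free array -/

section Words

variable {ι : Type*}

/-- The column index of a letter with row index `i` placed in front of `w`: the row index of the
first letter of `w`, or `i` itself if `w` is empty. -/
def nextIndex (i : ι) : List (ι × ℕ) → ι
  | [] => i
  | x :: _ => x.1

/-- The labels of the letters of a word given by the row indices and degrees. -/
def labels : List (ι × ℕ) → List (ι × ι)
  | [] => []
  | x :: w => (x.1, nextIndex x.1 w) :: labels w

/-- Words with positive degrees in which neighbouring labels differ. -/
def Admissible (w : List (ι × ℕ)) : Prop :=
  (labels w).IsChain (· ≠ ·) ∧ ∀ x ∈ w, 1 ≤ x.2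

theorem Admissible.nil : Admissible ([] : List (ι × ℕ)) := by
  simp [Admissible, labels]

theorem Admissible.tail {x : ι × ℕ} {w : List (ι × ℕ)} (h : Admissible (x :: w)) :
    Admissible w :=
  ⟨List.IsChain.tail h.1, fun y hy => h.2 y (List.mem_cons_of_mem _ hy)⟩

theorem Admissible.change_degree {i : ι} {k l : ℕ} {w : List (ι × ℕ)}
    (h : Admissible ((i, k) :: w)) (hl : 1 ≤ l) : Admissible ((i, l) :: w) := by
  refine ⟨h.1, fun y hy => ?_⟩
  rcases List.mem_cons.1 hy with rfl | hy
  · exact hl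
  · exact h.2 y (List.mem_cons_of_mem _ hy)

theorem Admissible.cons_singleton (i : ι) {k : ℕ} (hk : 1 ≤ k) : Admissible [(i, k)] := by
  simpa [Admissible, labels] using hk

theorem Admissible.cons_cons {i j : ι} {k l : ℕ} {w : List (ι × ℕ)}
    (h : Admissible ((j, k) :: w)) (hl : 1 ≤ l) (hne : (i, j) ≠ (j, nextIndex j w)) :
    Admissible ((i, l) :: (j, k) :: w) := by
  refine ⟨List.IsChain.cons_cons hne h.1, fun y hy => ?_⟩
  rcases List.mem_cons.1 hy with rfl | hy
  · exact hl
  · exact h.2 y hy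

/-- The encoding makes each column index the next row index, so composability is automatic and only
distinctness is an assumption. -/
theorem isChain_labels_comp {w : List (ι × ℕ)} (h : (labels w).IsChain (· ≠ ·)) :
    (labels w).IsChain (fun p q => p.2 = q.1 ∧ p ≠ q) := by
  induction w with
  | nil => simp [labels]
  | cons x w ih =>
    rcases w with _ | ⟨y, w⟩
    · simp [labels]
    · rw [labels, labels, List.isChain_cons_cons] at h ⊢
      exact ⟨⟨rfl, h.1⟩, ih h.2⟩

theorem getLast_labels (w : List (ι × ℕ)) : ∀ p ∈ (labels w).getLast?, p.1 = p.2 := by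
  induction w with
  | nil => simp [labels]
  | cons x w ih =>
    rcases w with _ | ⟨y, w⟩
    · simp [labels, nextIndex]
    · rw [labels, labels, List.getLast?_cons_cons]
      exact ih

theorem labels_mem_Lam {w : List (ι × ℕ)} (hw : w ≠ []) (h : (labels w).IsChain (· ≠ ·)) :
    labels w ∈ Lam ι := by
  refine ⟨?_, isChain_labels_comp h, getLast_labels w⟩
  rcases w with _ | ⟨x, w⟩
  · exact absurd rfl hw
  · simp [labels]

/-- The word `x :: w` is already a path with diagonal end; only the junction with `p` can fail. This
decides between creation and vanishing. -/
theorem cons_labels_mem_Lam_iff {p : ι × ι} {x : ι × ℕ} {w : List (ι × ℕ)}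
    (h : (labels (x :: w)).IsChain (· ≠ ·)) (hp : p ≠ (x.1, nextIndex x.1 w)) :
    p :: labels (x :: w) ∈ Lam ι ↔ p.2 = x.1 := by
  constructor
  · rintro ⟨-, h2, -⟩
    rw [labels, List.isChain_cons_cons] at h2
    exact h2.1.1
  · intro h2
    refine ⟨List.cons_ne_nil _ _, ?_, ?_⟩
    · have := isChain_labels_comp h
      rw [labels] at this ⊢
      exact List.IsChain.cons_cons ⟨h2, hp⟩ this
    · have := getLast_labels (x :: w)
      rw [labels] at this ⊢
      rw [List.getLast?_cons_cons]
      exact this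

end Words

/-! ### Left multiplication of reduced words by entries -/

section Array

variable {ι A : Type*} [DecidableEq ι] [Ring A] [Algebra ℂ A]
  (X : ι → ι → A) (e : ι × ι → A) (φ : A →ₗ[ℂ] ℂ) (ψ : ι → A →ₗ[ℂ] ℂ)

/-- The moments of the entries with respect to the array of states. -/
def entryMoment (p : ι × ι) (k : ℕ) : ℂ := stateArray φ ψ p (X p.1 p.2 ^ k)

/-- The centered power of an entry. -/
def letter (p : ι × ι) (k : ℕ) : A := X p.1 p.2 ^ k - entryMoment X φ ψ p k • e p

/-- The word of centered powers of entries. -/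
def letters : List (ι × ℕ) → List ((ι × ι) × A)
  | [] => []
  | x :: w => ((x.1, nextIndex x.1 w), letter X e φ ψ (x.1, nextIndex x.1 w) x.2) :: letters w

/-- The product of the centered powers of entries along a word. -/
def wordProd (w : List (ι × ℕ)) : A := ((letters X e φ ψ w).map Prod.snd).prod

theorem map_fst_letters (w : List (ι × ℕ)) :
    (letters X e φ ψ w).map Prod.fst = labels w := by
  induction w with
  | nil => rfl
  | cons x w ih => simp [letters, labels, ih]

theorem wordProd_nil : wordProd X e φ ψ [] = 1 := by simp [wordProd, letters]

theorem wordProd_cons (x : ι × ℕ) (w : List (ι × ℕ)) :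
    wordProd X e φ ψ (x :: w) =
      letter X e φ ψ (x.1, nextIndex x.1 w) x.2 * wordProd X e φ ψ w := by
  simp [wordProd, letters]

variable {X e φ ψ}
variable (hfree : IsMatriciallyFree (fun p => NonUnitalAlgebra.adjoin ℂ {X p.1 p.2, e p}) e φ ψ)
include hfree

theorem IsMatriciallyFree.stateArray_unit (p : ι × ι) : stateArray φ ψ p (e p) = 1 := by
  obtain ⟨i, j⟩ := p
  unfold stateArray
  split_ifs with h
  · have : i = j := h
    rw [hfree.internal.map_unit, if_pos this]
  · rw [hfree.internal.cond_unit, if_pos rfl]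

theorem IsMatriciallyFree.entry_mul_unit (p : ι × ι) : X p.1 p.2 * e p = X p.1 p.2 :=
  hfree.internal.mul_unit p _ (NonUnitalAlgebra.subset_adjoin ℂ (by simp))

theorem IsMatriciallyFree.letter_mem (p : ι × ι) {k : ℕ} (hk : 1 ≤ k) :
    letter X e φ ψ p k ∈ NonUnitalAlgebra.adjoin ℂ {X p.1 p.2, e p} := by
  have hX : X p.1 p.2 ∈ NonUnitalAlgebra.adjoin ℂ {X p.1 p.2, e p} :=
    NonUnitalAlgebra.subset_adjoin ℂ (by simp)
  have hpow : X p.1 p.2 ^ k ∈ NonUnitalAlgebra.adjoin ℂ {X p.1 p.2, e p} := by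
    induction k, hk using Nat.le_induction with
    | base => simpa using hX
    | succ k _ ih => rw [pow_succ]; exact mul_mem ih hX
  have hsmul := SMulMemClass.smul_mem (entryMoment X φ ψ p k) (hfree.internal.mem p)
  exact sub_mem hpow hsmul

theorem IsMatriciallyFree.isCentered_letters {w : List (ι × ℕ)} (hw : ∀ x ∈ w, 1 ≤ x.2) :
    IsCentered (fun p => NonUnitalAlgebra.adjoin ℂ {X p.1 p.2, e p}) φ ψ
      (letters X e φ ψ w) := by
  induction w with
  | nil => simp [IsCentered, letters]
  | cons x w ih =>
    intro y hy
    rw [letters, List.mem_cons] at hy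
    rcases hy with rfl | hy
    · refine ⟨hfree.letter_mem _ (hw x (by simp)), ?_⟩
      simp only [letter, map_sub, map_smul, hfree.stateArray_unit, smul_eq_mul, mul_one]
      exact sub_self _
    · exact ih (fun z hz => hw z (List.mem_cons_of_mem _ hz)) y hy

theorem IsMatriciallyFree.map_wordProd {w : List (ι × ℕ)} (hw : Admissible w) (hne : w ≠ []) :
    φ (wordProd X e φ ψ w) = 0 := by
  refine hfree.centered _ ?_ ?_ (hfree.isCentered_letters hw.2)
  · rcases w with _ | ⟨x, w⟩
    · exact absurd rfl hne
    · simp [letters]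
  · rw [map_fst_letters]; exact hw.1

variable (h1 : φ 1 = 1)
include h1

theorem IsMatriciallyFree.map_mul_unit (a : A) (i j : ι) :
    φ (a * e (i, j)) = if i = j then φ a else 0 := by
  have := hfree.units.factor 1 (one_mem _) (e (i, j))
    (Algebra.subset_adjoin (Set.mem_range_self _)) a
  rw [one_mul, h1, one_mul, hfree.internal.map_unit] at this
  rw [this]; simp

/-- For empty `w` the unit is diagonal and the factorization axiom applies; otherwise the unit is
followed by a path in `Lam` and can be removed. -/
theorem IsMatriciallyFree.map_unit_mul_wordProd {x : ι × ℕ} {w : List (ι × ℕ)}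
    (hw : Admissible (x :: w)) (a : A) :
    φ (a * e (x.1, nextIndex x.1 w) * wordProd X e φ ψ w) = φ (a * wordProd X e φ ψ w) := by
  rcases w with _ | ⟨y, w⟩
  · rw [wordProd_nil, mul_one, mul_one, nextIndex, hfree.map_mul_unit h1, if_pos rfl]
  · refine hfree.units.remove a _ (letters X e φ ψ (y :: w)) (by simp [letters]) ?_
      (hfree.isCentered_letters hw.tail.2) ?_
    · rw [map_fst_letters]; exact hw.1
    · rw [map_fst_letters]; exact labels_mem_Lam (List.cons_ne_nil x _) hw.1

variable (hmean : ∀ p, entryMoment X φ ψ p 1 = 0)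

omit hfree h1 in
include hmean in
theorem letter_one (p : ι × ι) : letter X e φ ψ p 1 = X p.1 p.2 := by
  rw [letter, hmean, zero_smul, sub_zero, pow_one]

include hmean in
/-- An entry acts on the empty word as a creation operator if it is diagonal, and as zero
otherwise. -/
theorem IsMatriciallyFree.map_entry_nil (a : A) (i j : ι) :
    φ (a * X i j * wordProd X e φ ψ []) =
      if i = j then φ (a * wordProd X e φ ψ [(i, 1)]) else 0 := by
  have hunit := hfree.entry_mul_unit (i, j)
  -- The axioms only speak about internal units, so one is inserted behind the entry.
  have hXe : a * X i j = a * X i j * e (i, j) := by rw [mul_assoc, hunit]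
  rw [wordProd_nil, mul_one, hXe, hfree.map_mul_unit h1]
  split_ifs with h
  · subst h
    rw [wordProd_cons, wordProd_nil, mul_one]
    simp only [nextIndex]
    rw [letter_one hmean]
  · rfl

omit h1 in
include hmean in
/-- An entry different from the first letter of a word acts as a creation operator if it matches
the word, and as zero otherwise. -/
theorem IsMatriciallyFree.map_entry_of_ne {x : ι × ℕ} {w : List (ι × ℕ)}
    (hw : Admissible (x :: w)) (a : A) (i j : ι) (hne : (i, j) ≠ (x.1, nextIndex x.1 w)) :
    φ (a * X i j * wordProd X e φ ψ (x :: w)) =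
      if j = x.1 then φ (a * wordProd X e φ ψ ((i, 1) :: x :: w)) else 0 := by
  have hunit := hfree.entry_mul_unit (i, j)
  have hXe : a * X i j = a * X i j * e (i, j) := by rw [mul_assoc, hunit]
  have hchain : ((i, j) :: (letters X e φ ψ (x :: w)).map Prod.fst).IsChain (· ≠ ·) := by
    rw [map_fst_letters]
    exact List.IsChain.cons_cons hne hw.1
  have hLam := cons_labels_mem_Lam_iff hw.1 hne
  rw [← map_fst_letters X e φ ψ] at hLam
  rw [hXe]
  split_ifs with h
  · refine (hfree.units.remove _ _ (letters X e φ ψ (x :: w)) (by simp [letters]) hchain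
      (hfree.isCentered_letters hw.2) (hLam.2 h)).trans ?_
    rw [wordProd_cons _ _ _ _ (i, 1)]
    subst h
    simp only [nextIndex]
    rw [letter_one hmean, ← mul_assoc]
    rfl
  · exact hfree.units.vanish _ _ (letters X e φ ψ (x :: w)) (by simp [letters]) hchain
      (hfree.isCentered_letters hw.2) fun h' => h (hLam.1 h')

include hmean in
/-- An entry acting on a word which starts with the same entry. -/
theorem IsMatriciallyFree.map_entry_self {i : ι} {k : ℕ} {w : List (ι × ℕ)}
    (hw : Admissible ((i, k) :: w)) (a : A) :
    φ (a * X i (nextIndex i w) * wordProd X e φ ψ ((i, k) :: w)) =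
      φ (a * wordProd X e φ ψ ((i, k + 1) :: w)) +
      entryMoment X φ ψ (i, nextIndex i w) (k + 1) * φ (a * wordProd X e φ ψ w) -
      entryMoment X φ ψ (i, nextIndex i w) k * φ (a * wordProd X e φ ψ ((i, 1) :: w)) := by
  have hunit := hfree.entry_mul_unit (i, nextIndex i w)
  have hrem := hfree.map_unit_mul_wordProd h1 hw a
  simp only at hunit hrem
  rw [← hrem]
  simp only [wordProd_cons]
  rw [letter_one hmean, letter, letter]
  -- With `c`, `c'` the moments of orders `k` and `k + 1`: `x (x^k - c E) = (x^(k+1) - c' E) + c' E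
  -- - c x`. The isolated unit `E` is the one already absorbed by `hrem`.
  have key : ∀ (x E W : A) (c c' : ℂ), x * E = x → a * x * ((x ^ k - c • E) * W) =
      a * ((x ^ (k + 1) - c' • E) * W) + c' • (a * E * W) - c • (a * (x * W)) := by
    intro x E W c c' h
    have h' : x * (E * W) = x * W := by rw [← mul_assoc, h]
    simp only [mul_sub, sub_mul, mul_smul_comm, smul_mul_assoc, mul_assoc, pow_succ', h']
    abel
  rw [key _ _ _ _ (entryMoment X φ ψ (i, nextIndex i w) (k + 1)) hunit, map_sub, map_add,
    map_smul, map_smul]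
  rfl

variable [Fintype ι]

include hmean in
theorem IsMatriciallyFree.map_sum_nil (a : A) :
    φ (a * (∑ i, ∑ j, X i j) * wordProd X e φ ψ []) =
      ∑ i, φ (a * wordProd X e φ ψ [(i, 1)]) := by
  simp only [Finset.mul_sum, Finset.sum_mul, map_sum, hfree.map_entry_nil h1 hmean,
    Finset.sum_ite_eq, Finset.mem_univ, if_true]

include hmean in
/-- The action of the sum of all entries on a nonempty word. -/
theorem IsMatriciallyFree.map_sum_cons {j : ι} {k : ℕ} {w : List (ι × ℕ)}
    (hw : Admissible ((j, k) :: w)) (a : A) :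
    φ (a * (∑ i, ∑ j, X i j) * wordProd X e φ ψ ((j, k) :: w)) =
      (∑ i, if (i, j) = (j, nextIndex j w) then 0 else
        φ (a * wordProd X e φ ψ ((i, 1) :: (j, k) :: w))) +
      (φ (a * wordProd X e φ ψ ((j, k + 1) :: w)) +
      entryMoment X φ ψ (j, nextIndex j w) (k + 1) * φ (a * wordProd X e φ ψ w) -
      entryMoment X φ ψ (j, nextIndex j w) k * φ (a * wordProd X e φ ψ ((j, 1) :: w))) := by
  rw [← hfree.map_entry_self h1 hmean hw]
  simp only [Finset.mul_sum, Finset.sum_mul, map_sum]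
  -- Creation needs column `j`, while the entry equal to the first letter lies in column `nextIndex
  -- j w`. The two columns may coincide, so that entry is excluded from the creation term.
  have hterm : ∀ i l, φ (a * X i l * wordProd X e φ ψ ((j, k) :: w)) =
      (if l = j then (if (i, j) = (j, nextIndex j w) then 0 else
        φ (a * wordProd X e φ ψ ((i, 1) :: (j, k) :: w))) else 0) +
      (if i = j then (if l = nextIndex j w then
        φ (a * X j (nextIndex j w) * wordProd X e φ ψ ((j, k) :: w)) else 0) else 0) := by
    intro i l
    by_cases h : (i, l) = (j, nextIndex j w)
    · obtain ⟨rfl, rfl⟩ := Prod.mk.inj h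
      rw [if_pos rfl, if_pos rfl]
      split_ifs with h2 h3
      · rw [zero_add]
      · exact absurd (by rw [h2]) h3
      · rw [zero_add]
    · rw [hfree.map_entry_of_ne hmean hw a i l h]
      simp only
      by_cases hl : l = j
      · subst hl
        rw [if_pos rfl, if_pos rfl, if_neg h]
        split_ifs with h2 h3
        · exact absurd (by rw [h2, ← h3]) h
        · rw [add_zero]
        · rw [add_zero]
      · rw [if_neg hl, if_neg hl, zero_add]
        split_ifs with h2 h3
        · exact absurd (by rw [h2, h3]) h
        · rfl
        · rfl
  have hsingle : ∀ V : ℂ, ∑ i, ∑ l, (if i = j then (if l = nextIndex j w then V else 0) else 0) =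
      V := by
    intro V
    rw [Finset.sum_eq_single_of_mem j (Finset.mem_univ j) fun i _ hi => by simp [hi]]
    simp
  rw [Finset.sum_congr rfl fun i _ => Finset.sum_congr rfl fun l _ => hterm i l]
  simp only [Finset.sum_add_distrib, Finset.sum_ite_eq', Finset.mem_univ, if_true, hsingle]

end Array

/-! ## Block sizes -/

section Blocks

variable {r : ℕ} {d : Fin r → ℝ}

/-- The partial sums of `d`. -/
noncomputable def partialSum (d : Fin r → ℝ) (j : ℕ) : ℝ :=
  ∑ l : Fin r with l.val < j, d l

theorem partialSum_mono (hd : ∀ k, 0 < d k) : Monotone (partialSum d) := by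
  intro i j hij
  refine Finset.sum_le_sum_of_subset_of_nonneg ?_ fun l _ _ => (hd l).le
  intro l hl
  simp only [Finset.mem_filter, Finset.mem_univ, true_and] at hl ⊢
  omega

theorem sum_Iio_eq_partialSum (d : Fin r → ℝ) (k : Fin r) :
    ∑ l ∈ Finset.Iio k, d l = partialSum d k := by
  refine Finset.sum_congr ?_ fun _ _ => rfl
  ext l
  simp only [Finset.mem_Iio, Finset.mem_filter, Finset.mem_univ, true_and]
  exact Iff.rfl

theorem sum_Iic_eq_partialSum (d : Fin r → ℝ) (k : Fin r) :
    ∑ l ∈ Finset.Iic k, d l = partialSum d (k + 1) := by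
  refine Finset.sum_congr ?_ fun _ _ => rfl
  ext l
  simp only [Finset.mem_Iic, Finset.mem_filter, Finset.mem_univ, true_and]
  exact Nat.lt_succ_iff.symm

theorem partialSum_succ (d : Fin r → ℝ) (k : Fin r) :
    partialSum d (k + 1) = partialSum d k + d k := by
  rw [← sum_Iio_eq_partialSum, ← sum_Iic_eq_partialSum, ← Finset.Iio_insert,
    Finset.sum_insert (by simp), add_comm]

theorem inBlock_iff {n : ℕ} {k : Fin r} {p : Fin n} :
    InBlock d n k p ↔ ⌊partialSum d k * n⌋ ≤ (p : ℤ) ∧ (p : ℤ) < ⌊partialSum d (k + 1) * n⌋ := by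
  rw [InBlock, sum_Iio_eq_partialSum, sum_Iic_eq_partialSum]

theorem exists_inBlock (hd1 : ∑ k, d k = 1) (n : ℕ) (p : Fin n) : ∃ k, InBlock d n k p := by
  have hex : ∃ j : ℕ, (p : ℤ) < ⌊partialSum d j * n⌋ := by
    refine ⟨r, ?_⟩
    have : partialSum d r = 1 := by
      rw [← hd1, partialSum]
      simp
    rw [this, one_mul, Int.floor_natCast]
    exact_mod_cast p.2
  classical
  have hspec := Nat.find_spec hex
  obtain ⟨j, hj⟩ : ∃ j, Nat.find hex = j + 1 := by
    refine Nat.exists_eq_succ_of_ne_zero fun h => ?_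
    rw [h] at hspec
    simp [partialSum] at hspec
    omega
  have hmin : ⌊partialSum d j * n⌋ ≤ (p : ℤ) := not_lt.1 (Nat.find_min hex (by omega))
  rw [hj] at hspec
  -- The partial sums are constant from `r` on, so the first one passing `p` has index at most `r`.
  have hjr : j < r := by
    by_contra! h
    have : partialSum d (j + 1) = partialSum d j := by
      refine Finset.sum_congr ?_ fun _ _ => rfl
      ext l
      have := l.2
      simp only [Finset.mem_filter, Finset.mem_univ, true_and]
      omega
    rw [this] at hspec
    omega
  exact ⟨⟨j, hjr⟩, inBlock_iff.2 ⟨hmin, hspec⟩⟩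

theorem InBlock.unique (hd : ∀ k, 0 < d k) {n : ℕ} {k k' : Fin r} {p : Fin n}
    (h : InBlock d n k p) (h' : InBlock d n k' p) : k = k' := by
  rw [inBlock_iff] at h h'
  have key : ∀ {a b : Fin r}, (p : ℤ) < ⌊partialSum d (a + 1) * n⌋ →
      ⌊partialSum d b * n⌋ ≤ (p : ℤ) → b ≤ a := by
    intro a b ha hb
    by_contra! hab
    have : ⌊partialSum d (a + 1) * n⌋ ≤ ⌊partialSum d b * n⌋ :=
      Int.floor_le_floor (mul_le_mul_of_nonneg_right (partialSum_mono hd hab) n.cast_nonneg)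
    omega
  exact le_antisymm (key h'.2 h.1) (key h.2 h'.1)

/-- A block is an interval between two floors, each of which costs less than one. -/
theorem abs_card_block_sub_le (hd : ∀ k, 0 < d k) (hd1 : ∑ k, d k = 1) {n : ℕ}
    {blk : Fin n → Fin r} (hblk : ∀ i, InBlock d n (blk i) i) (k : Fin r) :
    |((Finset.univ.filter fun i => blk i = k).card : ℝ) - d k * n| ≤ 1 := by
  set a := ⌊partialSum d k * n⌋ with ha
  set b := ⌊partialSum d (k + 1) * n⌋ with hb
  have ha0 : 0 ≤ a := Int.floor_nonneg.2 (mul_nonneg (Finset.sum_nonneg fun l _ => (hd l).le)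
    n.cast_nonneg)
  have hbn : b ≤ n := by
    have h1 : partialSum d (k + 1) ≤ 1 := by
      rw [← hd1]
      exact Finset.sum_le_sum_of_subset_of_nonneg (Finset.subset_univ _) fun l _ _ => (hd l).le
    have : b ≤ ⌊(n : ℝ)⌋ := Int.floor_le_floor (mul_le_of_le_one_left n.cast_nonneg h1)
    simpa using this
  have hab : a ≤ b :=
    Int.floor_le_floor (mul_le_mul_of_nonneg_right (partialSum_mono hd (Nat.le_succ _))
      n.cast_nonneg)
  have hcard : (Finset.univ.filter fun i => blk i = k).card = (Finset.Ico a b).card := by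
    refine Finset.card_bij (fun i _ => (i : ℤ)) (fun i hi => ?_) (fun i _ j _ hij => ?_)
      fun q hq => ?_
    · have := hblk i
      rw [(Finset.mem_filter.1 hi).2, inBlock_iff] at this
      exact Finset.mem_Ico.2 this
    · exact Fin.ext (by exact_mod_cast hij)
    · rw [Finset.mem_Ico] at hq
      lift q to ℕ using ha0.trans hq.1
      have hqn : q < n := by omega
      refine ⟨⟨q, hqn⟩, ?_, rfl⟩
      rw [Finset.mem_filter]
      exact ⟨Finset.mem_univ _, (hblk _).unique hd (inBlock_iff.2 hq)⟩
  have hreal : ((Finset.univ.filter fun i => blk i = k).card : ℝ) = b - a := by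
    rw [hcard, Int.card_Ico, ← Int.cast_natCast, Int.toNat_of_nonneg (by omega)]
    push_cast
    rfl
  have h1 := Int.floor_le (partialSum d k * n)
  have h2 := Int.lt_floor_add_one (partialSum d k * n)
  have h3 := Int.floor_le (partialSum d (k + 1) * n)
  have h4 := Int.lt_floor_add_one (partialSum d (k + 1) * n)
  have h5 : partialSum d (k + 1) * n = partialSum d k * n + d k * n := by
    rw [partialSum_succ]; ring
  rw [hreal, abs_le]
  constructor <;> linarith

/-- Averages of block functions converge to the weighted sums. -/
theorem norm_average_sub_le (hd : ∀ k, 0 < d k) (hd1 : ∑ k, d k = 1) {n : ℕ} (hn : 1 ≤ n)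
    {blk : Fin n → Fin r} (hblk : ∀ i, InBlock d n (blk i) i) (g : Fin n → ℂ) (h : Fin r → ℂ) :
    ‖(n : ℂ)⁻¹ * ∑ i, g i - ∑ k, d k * h k‖ ≤
      (n : ℝ)⁻¹ * ∑ i, ‖g i - h (blk i)‖ + (n : ℝ)⁻¹ * ∑ k, ‖h k‖ := by
  have hn0 : (n : ℂ) ≠ 0 := by exact_mod_cast (by omega : n ≠ 0)
  have hcomp : ∑ i, h (blk i) = ∑ k, ((Finset.univ.filter fun i => blk i = k).card : ℂ) * h k := by
    rw [← Finset.sum_fiberwise Finset.univ blk]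
    refine Finset.sum_congr rfl fun k _ => ?_
    rw [Finset.sum_congr rfl fun i hi => by rw [(Finset.mem_filter.1 hi).2], Finset.sum_const,
      nsmul_eq_mul]
  have e : (n : ℂ)⁻¹ * ∑ i, g i - ∑ k, d k * h k =
      (n : ℂ)⁻¹ * ∑ i, (g i - h (blk i)) +
      (n : ℂ)⁻¹ * ∑ k, (((Finset.univ.filter fun i => blk i = k).card : ℂ) - d k * n) * h k := by
    simp only [Finset.sum_sub_distrib, sub_mul, hcomp]
    have : ∑ k, (d k : ℂ) * n * h k = n * ∑ k, d k * h k := by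
      rw [Finset.mul_sum]
      exact Finset.sum_congr rfl fun k _ => by ring
    rw [this]
    field_simp
    ring
  rw [e]
  refine (norm_add_le _ _).trans ?_
  rw [norm_mul, norm_mul, norm_inv, Complex.norm_natCast]
  gcongr
  · exact norm_sum_le _ _
  · refine (norm_sum_le _ _).trans (Finset.sum_le_sum fun k _ => ?_)
    rw [norm_mul]
    refine mul_le_of_le_one_left (norm_nonneg _) ?_
    have := abs_card_block_sub_le hd hd1 hblk k
    rw [← Real.norm_eq_abs, ← Complex.norm_real] at this
    simpa using this

end Blocks

/-! ## Asymptotics of the word recursion -/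

/-- The recursion satisfied by the functionals `w ↦ φ(Sᵐ w)` on reduced words. -/
structure WordRecursion {ι : Type*} [Fintype ι] [DecidableEq ι]
    (f : ℕ → List (ι × ℕ) → ℂ) (mom : ι × ι → ℕ → ℂ) : Prop where
  zero_nil : f 0 [] = 1
  zero_cons : ∀ x w, Admissible (x :: w) → f 0 (x :: w) = 0
  succ_nil : ∀ m, f (m + 1) [] = ∑ i, f m [(i, 1)]
  succ_cons : ∀ m j k w, Admissible ((j, k) :: w) → f (m + 1) ((j, k) :: w) =
    (∑ i, if (i, j) = (j, nextIndex j w) then 0 else f m ((i, 1) :: (j, k) :: w)) +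
    (f m ((j, k + 1) :: w) + mom (j, nextIndex j w) (k + 1) * f m w -
      mom (j, nextIndex j w) k * f m ((j, 1) :: w))
  mom_one : ∀ p, mom p 1 = 0

/-- The rightmost factor of `S ^ (m + 1)` is the one that acts on the word; the remaining `S ^ m` is
the arbitrary left factor `a` of the preceding lemmas. -/
theorem IsMatriciallyFree.wordRecursion {ι A : Type*} [Fintype ι] [DecidableEq ι] [Ring A]
    [Algebra ℂ A] {X : ι → ι → A} {e : ι × ι → A} {φ : A →ₗ[ℂ] ℂ} {ψ : ι → A →ₗ[ℂ] ℂ}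
    (hfree : IsMatriciallyFree (fun p => NonUnitalAlgebra.adjoin ℂ {X p.1 p.2, e p}) e φ ψ)
    (h1 : φ 1 = 1) (hmean : ∀ p, entryMoment X φ ψ p 1 = 0) :
    WordRecursion (fun m w => φ ((∑ i, ∑ j, X i j) ^ m * wordProd X e φ ψ w))
      (entryMoment X φ ψ) where
  zero_nil := by simp [wordProd_nil, h1]
  zero_cons x w hw := by
    simpa using hfree.map_wordProd hw (List.cons_ne_nil x w)
  succ_nil m := by
    simp only [pow_succ]
    exact hfree.map_sum_nil h1 hmean _
  succ_cons m j k w hw := by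
    simp only [pow_succ]
    exact hfree.map_sum_cons h1 hmean hw _
  mom_one := hmean

/-- The natural order of magnitude of a word with the given degrees, as a power of `n^(-1/2)`. -/
def wordWeight (ks : List ℕ) : ℕ := (ks.map (· + 1)).sum

theorem wordWeight_cons (k : ℕ) (ks : List ℕ) :
    wordWeight (k :: ks) = k + 1 + wordWeight ks := by simp [wordWeight]

section Asymptotics

variable {f : ∀ n : ℕ, ℕ → List (Fin n × ℕ) → ℂ} {mom : ∀ n : ℕ, Fin n × Fin n → ℕ → ℂ}

/-- The functionals of words are bounded by their natural order of magnitude. -/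
theorem exists_word_bound (hrec : ∀ n, WordRecursion (f n) (mom n))
    (hmom : ∀ k, ∃ M : ℝ, 0 ≤ M ∧ ∀ n, 1 ≤ n → ∀ p, ‖mom n p k‖ ≤ M * (√n)⁻¹ ^ k) (m : ℕ) :
    ∀ ks : List ℕ, ∃ C : ℝ, 0 ≤ C ∧ ∀ n, 1 ≤ n → ∀ w : List (Fin n × ℕ), Admissible w →
      w.map Prod.snd = ks → ‖f n m w‖ ≤ C * (√n)⁻¹ ^ wordWeight ks := by
  induction m with
  | zero =>
    intro ks
    refine ⟨1, zero_le_one, fun n hn w hw hks => ?_⟩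
    rcases w with _ | ⟨x, w⟩
    · subst hks
      simp [(hrec n).zero_nil, wordWeight]
    · rw [(hrec n).zero_cons x w hw, norm_zero]
      positivity
  | succ m ih =>
    have hs1 : ∀ n : ℕ, 1 ≤ n → (√(n : ℝ))⁻¹ ≤ 1 := fun n hn =>
      inv_le_one_of_one_le₀ (Real.one_le_sqrt.2 (by exact_mod_cast hn))
    have hs2 : ∀ n : ℕ, 1 ≤ n → (n : ℝ) * (√(n : ℝ))⁻¹ ^ 2 = 1 := fun n hn => by
      have : (0 : ℝ) < n := by exact_mod_cast hn
      rw [inv_pow, Real.sq_sqrt this.le, mul_inv_cancel₀ this.ne']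
    intro ks
    rcases ks with _ | ⟨k, ks⟩
    · obtain ⟨C, hC0, hC⟩ := ih [1]
      refine ⟨C, hC0, fun n hn w hw hks => ?_⟩
      rw [List.map_eq_nil_iff] at hks
      subst hks
      rw [(hrec n).succ_nil]
      calc _ ≤ ∑ i : Fin n, C * (√n)⁻¹ ^ wordWeight [1] :=
            (norm_sum_le _ _).trans (Finset.sum_le_sum fun i _ =>
              hC n hn _ (Admissible.cons_singleton i le_rfl) rfl)
        _ = C * ((n : ℝ) * (√n)⁻¹ ^ 2) := by
            rw [Finset.sum_const, Finset.card_univ, Fintype.card_fin, nsmul_eq_mul]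
            simp only [wordWeight, List.map_cons, List.map_nil, List.sum_cons, List.sum_nil]
            ring
        _ = _ := by rw [hs2 n hn]; simp [wordWeight]
    · obtain ⟨C₁, hC₁0, hC₁⟩ := ih (1 :: k :: ks)
      obtain ⟨C₂, hC₂0, hC₂⟩ := ih ((k + 1) :: ks)
      obtain ⟨C₃, hC₃0, hC₃⟩ := ih ks
      obtain ⟨C₄, hC₄0, hC₄⟩ := ih (1 :: ks)
      obtain ⟨M₁, hM₁0, hM₁⟩ := hmom (k + 1)
      obtain ⟨M₀, hM₀0, hM₀⟩ := hmom k
      refine ⟨C₁ + (C₂ + M₁ * C₃ + M₀ * C₄), by positivity, fun n hn w hw hks => ?_⟩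
      rcases w with _ | ⟨⟨j, k'⟩, w⟩
      · simp at hks
      rw [List.map_cons, List.cons.injEq] at hks
      obtain ⟨rfl, hks⟩ := hks
      simp only at hC₁ hC₂ hM₁ hM₀
      have hk' : 1 ≤ k' := hw.2 (j, k') (by simp)
      rw [(hrec n).succ_cons m j k' w hw]
      set s : ℝ := (√n)⁻¹ with hs
      have hs0 : 0 ≤ s := by positivity
      set W := wordWeight (k' :: ks) with hW
      have hsW : s ^ (W + 1) ≤ s ^ W := pow_le_pow_of_le_one hs0 (hs1 n hn) (Nat.le_succ W)
      -- Balance of weights: creation adds weight two, which pays for the `n` choices of the row;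
      -- removing a letter of degree `k'` trades weight `k' + 1` for a moment of that order. Raising
      -- and resetting the degree each gain an extra `n^(-1/2)`.
      have t1 : ‖∑ i, if (i, j) = (j, nextIndex j w) then 0 else
          f n m ((i, 1) :: (j, k') :: w)‖ ≤ C₁ * s ^ W := by
        calc _ ≤ ∑ i : Fin n, C₁ * s ^ (W + 2) := by
              refine (norm_sum_le _ _).trans (Finset.sum_le_sum fun i _ => ?_)
              split_ifs with h
              · rw [norm_zero]; positivity
              · refine (hC₁ n hn _ (hw.cons_cons le_rfl h) (by simp [hks])).trans (le_of_eq ?_)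
                rw [wordWeight_cons 1, ← hW, add_comm W]
          _ = C₁ * s ^ W * (n * s ^ 2) := by
              rw [Finset.sum_const, Finset.card_univ, Fintype.card_fin, nsmul_eq_mul]
              ring
          _ = _ := by rw [hs2 n hn, mul_one]
      have t2 : ‖f n m ((j, k' + 1) :: w)‖ ≤ C₂ * s ^ W := by
        refine (hC₂ n hn _ (hw.change_degree (Nat.le_add_left 1 k')) (by simp [hks])).trans ?_
        have : wordWeight ((k' + 1) :: ks) = W + 1 := by
          rw [hW, wordWeight_cons, wordWeight_cons]; ring
        rw [this]
        gcongr
      have t3 : ‖mom n (j, nextIndex j w) (k' + 1) * f n m w‖ ≤ M₁ * C₃ * s ^ W := by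
        rw [norm_mul]
        calc _ ≤ (M₁ * s ^ (k' + 1)) * (C₃ * s ^ wordWeight ks) :=
              mul_le_mul (hM₁ n hn _) (hC₃ n hn _ hw.tail hks) (norm_nonneg _) (by positivity)
          _ = _ := by rw [hW, wordWeight_cons, pow_add s (k' + 1)]; ring
      have t4 : ‖mom n (j, nextIndex j w) k' * f n m ((j, 1) :: w)‖ ≤ M₀ * C₄ * s ^ W := by
        rw [norm_mul]
        calc _ ≤ (M₀ * s ^ k') * (C₄ * s ^ wordWeight (1 :: ks)) :=
              mul_le_mul (hM₀ n hn _) (hC₄ n hn _ (hw.change_degree le_rfl) (by simp [hks]))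
                (norm_nonneg _) (by positivity)
          _ = M₀ * C₄ * s ^ (W + 1) := by
              rw [hW, wordWeight_cons, wordWeight_cons]
              ring
          _ ≤ _ := by gcongr
      have := norm_add_le (∑ i, if (i, j) = (j, nextIndex j w) then 0 else
          f n m ((i, 1) :: (j, k') :: w)) (f n m ((j, k' + 1) :: w) +
        mom n (j, nextIndex j w) (k' + 1) * f n m w -
        mom n (j, nextIndex j w) k' * f n m ((j, 1) :: w))
      have := norm_sub_le (f n m ((j, k' + 1) :: w) +
        mom n (j, nextIndex j w) (k' + 1) * f n m w)
        (mom n (j, nextIndex j w) k' * f n m ((j, 1) :: w))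
      have := norm_add_le (f n m ((j, k' + 1) :: w))
        (mom n (j, nextIndex j w) (k' + 1) * f n m w)
      linarith

variable {r : ℕ} {d : Fin r → ℝ} {U : Matrix (Fin r) (Fin r) ℝ}

/-- The words whose letters all have degree one. -/
def degreeOneWord {ι : Type*} (v : List ι) : List (ι × ℕ) := v.map fun i => (i, 1)

theorem wordWeight_replicate_one (l : ℕ) : wordWeight (List.replicate l 1) = 2 * l := by
  simp [wordWeight, mul_comm]

theorem nextIndex_degreeOneWord {ι κ : Type*} (b : ι → κ) (j : ι) (v : List ι) :
    b (nextIndex j (degreeOneWord v)) = (v.map b).headD (b j) := by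
  cases v <;> rfl

/-- The recursion satisfied by the limits of the rescaled functionals, on words of blocks. -/
structure LimitRecursion (d : Fin r → ℝ) (U : Matrix (Fin r) (Fin r) ℝ)
    (F : ℕ → List (Fin r) → ℂ) : Prop where
  zero_nil : F 0 [] = 1
  zero_cons : ∀ k κ, F 0 (k :: κ) = 0
  succ_nil : ∀ m, F (m + 1) [] = ∑ k, d k * F m [k]
  succ_cons : ∀ m k κ, F (m + 1) (k :: κ) =
    ∑ l, d l * F m (l :: k :: κ) + U k (κ.headD k) * F m κ

/-- The rescaled functionals of degree-one words converge uniformly. -/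
theorem exists_word_limit (hd : ∀ k, 0 < d k) (hd1 : ∑ k, d k = 1)
    (hrec : ∀ n, WordRecursion (f n) (mom n))
    (hmom : ∀ k, ∃ M : ℝ, 0 ≤ M ∧ ∀ n, 1 ≤ n → ∀ p, ‖mom n p k‖ ≤ M * (√n)⁻¹ ^ k)
    {blk : ∀ n, Fin n → Fin r} (hblk : ∀ n i, InBlock d n (blk n i) i)
    (hvar : ∀ n i j, mom n (i, j) 2 = ((U (blk n i) (blk n j) / n : ℝ) : ℂ))
    {F : ℕ → List (Fin r) → ℂ} (hF : LimitRecursion d U F) (m : ℕ) :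
    ∀ l : ℕ, ∃ δ : ℕ → ℝ, Tendsto δ atTop (𝓝 0) ∧ (∀ n, 0 ≤ δ n) ∧ ∀ n, 1 ≤ n →
      ∀ v : List (Fin n), v.length = l → Admissible (degreeOneWord v) →
        ‖(n : ℂ) ^ l * f n m (degreeOneWord v) - F m (v.map (blk n))‖ ≤ δ n := by
  have hinv : Tendsto (fun n : ℕ => (n : ℝ)⁻¹) atTop (𝓝 0) := tendsto_inv_atTop_nhds_zero_nat
  -- There are only finitely many block words of a given length.
  have hFbound : ∀ m l, ∃ B : ℝ, 0 ≤ B ∧ ∀ κ : List (Fin r), κ.length = l → ‖F m κ‖ ≤ B := by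
    intro m l
    obtain ⟨B, hB⟩ := ((List.finite_length_eq (Fin r) l).image fun κ => ‖F m κ‖).bddAbove
    exact ⟨max B 0, le_max_right _ _, fun κ hκ =>
      (hB (Set.mem_image_of_mem _ hκ)).trans (le_max_left _ _)⟩
  induction m with
  | zero =>
    intro l
    refine ⟨fun _ => 0, tendsto_const_nhds, fun _ => le_rfl, fun n hn v hv hadm => ?_⟩
    rcases v with _ | ⟨j, v⟩
    · subst hv
      simp [degreeOneWord, (hrec n).zero_nil, hF.zero_nil]
    · have : f n 0 (degreeOneWord (j :: v)) = 0 := (hrec n).zero_cons _ _ hadm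
      simp [this, hF.zero_cons]
  | succ m ih =>
    intro l
    rcases l with _ | l
    · obtain ⟨δ, hδ, hδ0, hδb⟩ := ih 1
      refine ⟨fun n => δ n + (n : ℝ)⁻¹ * ∑ k, ‖F m [k]‖, ?_, fun n => ?_, fun n hn v hv _ => ?_⟩
      · simpa using hδ.add (hinv.mul_const (∑ k, ‖F m [k]‖))
      · have := hδ0 n
        positivity
      · have hn0 : (n : ℂ) ≠ 0 := by exact_mod_cast (by omega : n ≠ 0)
        have hn0' : (n : ℝ) ≠ 0 := by exact_mod_cast (by omega : n ≠ 0)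
        rw [List.length_eq_zero_iff] at hv
        subst hv
        have h := norm_average_sub_le hd hd1 hn (hblk n) (fun i => n * f n m [(i, 1)])
          (fun k => F m [k])
        rw [← Finset.mul_sum, inv_mul_cancel_left₀ hn0] at h
        have e : (n : ℂ) ^ 0 * f n (m + 1) (degreeOneWord []) = ∑ i, f n m [(i, 1)] := by
          rw [pow_zero, one_mul]; exact (hrec n).succ_nil m
        rw [e, List.map_nil, hF.succ_nil]
        refine h.trans (add_le_add_left ?_ _)
        calc _ ≤ (n : ℝ)⁻¹ * ∑ i : Fin n, δ n := by
              gcongr with i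
              have := hδb n hn [i] rfl (Admissible.cons_singleton i le_rfl)
              simpa [degreeOneWord] using this
          _ = δ n := by
              rw [Finset.sum_const, Finset.card_univ, Fintype.card_fin, nsmul_eq_mul,
                inv_mul_cancel_left₀ hn0']
    · obtain ⟨δ₁, hδ₁, hδ₁0, hδ₁b⟩ := ih (l + 2)
      obtain ⟨δ₂, hδ₂, hδ₂0, hδ₂b⟩ := ih l
      obtain ⟨B, hB0, hB⟩ := hFbound m (l + 2)
      obtain ⟨C, hC0, hC⟩ := exists_word_bound hrec hmom m (2 :: List.replicate l 1)
      set u := ∑ k, ∑ k', |U k k'| with hu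
      have hu0 : 0 ≤ u := Finset.sum_nonneg fun _ _ => Finset.sum_nonneg fun _ _ => abs_nonneg _
      have hUu : ∀ k k', |U k k'| ≤ u := fun k k' =>
        (Finset.single_le_sum (f := fun k' => |U k k'|) (fun _ _ => abs_nonneg _)
          (Finset.mem_univ k')).trans
          (Finset.single_le_sum (f := fun k => ∑ k', |U k k'|)
            (fun _ _ => Finset.sum_nonneg fun _ _ => abs_nonneg _) (Finset.mem_univ k))
      have hsqrt : Tendsto (fun n : ℕ => (√(n : ℝ))⁻¹) atTop (𝓝 0) :=
        tendsto_inv_atTop_zero.comp (Real.tendsto_sqrt_atTop.comp tendsto_natCast_atTop_atTop)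
      -- The errors, in order: convergence of the longer words, the single row possibly excluded
      -- from creation, rounding of the block sizes, the word with a letter of degree two,
      -- convergence of the shorter word.
      refine ⟨fun n => ((δ₁ n + (n : ℝ)⁻¹ * B) + (n : ℝ)⁻¹ * (r * B)) + C * (√n)⁻¹ + u * δ₂ n,
        ?_, fun n => ?_, fun n hn v hv hadm => ?_⟩
      · simpa using (((hδ₁.add (hinv.mul_const B)).add (hinv.mul_const (r * B))).add
          (hsqrt.const_mul C)).add (hδ₂.const_mul u)
      · have := hδ₁0 n
        have := hδ₂0 n
        positivity
      · have hn0 : (n : ℂ) ≠ 0 := by exact_mod_cast (by omega : n ≠ 0)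
        have hn0' : (n : ℝ) ≠ 0 := by exact_mod_cast (by omega : n ≠ 0)
        have hnpos : (0 : ℝ) < n := by exact_mod_cast hn
        rcases v with _ | ⟨j, v⟩
        · simp at hv
        have hvl : v.length = l := by simpa using hv
        have hadm' : Admissible ((j, 1) :: degreeOneWord v) := hadm
        set w := degreeOneWord v with hw
        set κ := v.map (blk n) with hκ
        set g : Fin n → ℂ := fun i => if (i, j) = (j, nextIndex j w) then 0 else
          (n : ℂ) ^ (l + 2) * f n m ((i, 1) :: (j, 1) :: w) with hg
        have hmomv : mom n (j, nextIndex j w) 2 = ((U (blk n j) (κ.headD (blk n j)) / n : ℝ) : ℂ) := by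
          rw [hvar, nextIndex_degreeOneWord (blk n)]
        have e1 : (n : ℂ) ^ (l + 1) * f n (m + 1) ((j, 1) :: w) -
            F (m + 1) (blk n j :: κ) =
            ((n : ℂ)⁻¹ * ∑ i, g i - ∑ k, d k * F m (k :: blk n j :: κ)) +
            (n : ℂ) ^ (l + 1) * f n m ((j, 2) :: w) +
            U (blk n j) (κ.headD (blk n j)) * ((n : ℂ) ^ l * f n m w - F m κ) := by
          rw [(hrec n).succ_cons m j 1 w hadm', hF.succ_cons, (hrec n).mom_one]
          have hsum : (n : ℂ)⁻¹ * ∑ i, g i = (n : ℂ) ^ (l + 1) *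
              ∑ i, if (i, j) = (j, nextIndex j w) then 0 else
                f n m ((i, 1) :: (j, 1) :: w) := by
            rw [Finset.mul_sum, Finset.mul_sum]
            refine Finset.sum_congr rfl fun i _ => ?_
            simp only [hg]
            split_ifs
            · simp
            · rw [pow_succ]; field_simp
          rw [hsum]
          show _ * (_ + (f n m ((j, 2) :: w) + mom n (j, nextIndex j w) 2 * _ - _)) - _ = _
          rw [hmomv]
          push_cast
          rw [pow_succ]
          field_simp
          ring
        have t1 : ‖(n : ℂ)⁻¹ * ∑ i, g i - ∑ k, d k * F m (k :: blk n j :: κ)‖ ≤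
            (δ₁ n + (n : ℝ)⁻¹ * B) + (n : ℝ)⁻¹ * (r * B) := by
          have hlen : ∀ k, ‖F m (k :: blk n j :: κ)‖ ≤ B := fun k => hB _ (by simp [hκ, hvl])
          refine (norm_average_sub_le hd hd1 hn (hblk n) g
            (fun k => F m (k :: blk n j :: κ))).trans (add_le_add ?_ ?_)
          · calc _ ≤ (n : ℝ)⁻¹ * ∑ i : Fin n, (δ₁ n + if i = j then B else 0) := by
                  gcongr with i
                  simp only [hg]
                  split_ifs with h1 h2 h2
                  · rw [zero_sub, norm_neg]
                    linarith [hlen (blk n i), hδ₁0 n]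
                  · exact absurd (Prod.mk.inj h1).1 h2
                  · have := hδ₁b n hn (i :: j :: v) (by simp [hvl])
                      (hadm'.cons_cons le_rfl h1)
                    exact this.trans (by linarith)
                  · have := hδ₁b n hn (i :: j :: v) (by simp [hvl])
                      (hadm'.cons_cons le_rfl h1)
                    exact this.trans (by linarith)
              _ = _ := by
                  rw [Finset.sum_add_distrib, Finset.sum_const, Finset.card_univ,
                    Fintype.card_fin, nsmul_eq_mul, Finset.sum_ite_eq', if_pos (Finset.mem_univ _),
                    mul_add, inv_mul_cancel_left₀ hn0']
          · gcongr
            calc _ ≤ ∑ k : Fin r, B := Finset.sum_le_sum fun k _ => hlen k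
              _ = _ := by simp
        have t2 : ‖(n : ℂ) ^ (l + 1) * f n m ((j, 2) :: w)‖ ≤ C * (√n)⁻¹ := by
          have h := hC n hn ((j, 2) :: w) (hadm'.change_degree one_le_two) (by
            simp [hw, degreeOneWord, List.map_map, Function.comp_def, ← hvl])
          rw [norm_mul, norm_pow, Complex.norm_natCast]
          calc _ ≤ (n : ℝ) ^ (l + 1) * (C * (√n)⁻¹ ^ wordWeight (2 :: List.replicate l 1)) := by
                gcongr
            _ = C * (√n)⁻¹ * (n * (√n)⁻¹ ^ 2) ^ (l + 1) := by
                rw [wordWeight_cons, wordWeight_replicate_one]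
                ring
            _ = _ := by
                rw [inv_pow, Real.sq_sqrt hnpos.le, mul_inv_cancel₀ hn0', one_pow, mul_one]
        have t3 : ‖(U (blk n j) (κ.headD (blk n j)) : ℂ) * ((n : ℂ) ^ l * f n m w - F m κ)‖ ≤
            u * δ₂ n := by
          rw [norm_mul, Complex.norm_real, Real.norm_eq_abs]
          exact mul_le_mul (hUu _ _) (hδ₂b n hn v hvl hadm'.tail) (norm_nonneg _) hu0
        show ‖(n : ℂ) ^ (l + 1) * f n (m + 1) ((j, 1) :: w) - F (m + 1) (blk n j :: κ)‖ ≤ _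
        rw [e1]
        exact (norm_add₃_le).trans (add_le_add (add_le_add t1 t2) t3)

end Asymptotics

/-! ### Generating series solving the limit recursion -/

section LimitSeries

open PowerSeries

variable {r : ℕ}

/-- The generating series of the limits of the rescaled functionals. -/
noncomputable def wordSeries (U : Matrix (Fin r) (Fin r) ℝ) (S : Fin r → PowerSeries ℝ)
    (S₀ : PowerSeries ℝ) : List (Fin r) → PowerSeries ℝ
  | [] => S₀
  | k :: κ => X * (C (U k (κ.headD k)) * S k * wordSeries U S S₀ κ)

/-- In `S_k = 1 + X² (∑ d_p U_{p,k} S_p) S_k` the term `1` means that the letter is removed at once,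
the rest that another letter is first created in front of it and later removed. For the empty word
the created letter is diagonal, whence the coefficients `U p p`. -/
theorem limitRecursion_wordSeries {d : Fin r → ℝ} {U : Matrix (Fin r) (Fin r) ℝ}
    {S : Fin r → PowerSeries ℝ} {S₀ : PowerSeries ℝ}
    (hS : ∀ i, branchDen (fun p => d p * U p i) S * S i = 1)
    (hS₀ : branchDen (fun p => d p * U p p) S * S₀ = 1) :
    LimitRecursion d U (fun m κ => ((coeff m (wordSeries U S S₀ κ) : ℝ) : ℂ)) := by
  have hnil : S₀ = 1 + X * ∑ k, C (d k) * wordSeries U S S₀ [k] := by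
    have h : S₀ = 1 + X ^ 2 * (∑ p, C (d p * U p p) * S p) * S₀ := by
      rw [branchDen] at hS₀
      linear_combination hS₀
    have e : ∑ k, C (d k) * wordSeries U S S₀ [k] = X * (∑ p, C (d p * U p p) * S p) * S₀ := by
      rw [Finset.mul_sum, Finset.sum_mul]
      refine Finset.sum_congr rfl fun k _ => ?_
      simp only [wordSeries, List.headD_nil, map_mul]
      ring
    rw [e]
    linear_combination h
  have hcons : ∀ k κ, wordSeries U S S₀ (k :: κ) =
      X * (∑ l, C (d l) * wordSeries U S S₀ (l :: k :: κ) +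
        C (U k (κ.headD k)) * wordSeries U S S₀ κ) := by
    intro k κ
    have h : S k = 1 + X ^ 2 * (∑ p, C (d p * U p k) * S p) * S k := by
      have := hS k
      rw [branchDen] at this
      linear_combination this
    have e : ∑ l, C (d l) * wordSeries U S S₀ (l :: k :: κ) =
        X * (∑ p, C (d p * U p k) * S p) * wordSeries U S S₀ (k :: κ) := by
      rw [Finset.mul_sum, Finset.sum_mul]
      refine Finset.sum_congr rfl fun l _ => ?_
      rw [wordSeries, List.headD_cons, map_mul]
      ring
    rw [e, wordSeries]
    linear_combination (X * C (U k (κ.headD k)) * wordSeries U S S₀ κ) * h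
  refine ⟨?_, fun k κ => ?_, fun m => ?_, fun m k κ => ?_⟩
  · rw [wordSeries, hnil]
    simp
  · rw [wordSeries]
    simp
  · rw [wordSeries]
    conv_lhs => rw [hnil]
    rw [map_add, coeff_succ_X_mul, coeff_one, if_neg (Nat.succ_ne_zero m), zero_add, map_sum]
    simp only [coeff_C_mul]
    push_cast
    rfl
  · rw [hcons, coeff_succ_X_mul, map_add, map_sum]
    simp only [coeff_C_mul]
    push_cast
    rfl

end LimitSeries

end MatFree

/-! ### Assembly of the limit theorem -/

theorem theorem7p2 {r : ℕ} (d : Fin r → ℝ) (hd : ∀ k, 0 < d k) (hd1 : ∑ k, d k = 1)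
    (U : Matrix (Fin r) (Fin r) ℝ) (hUdiag : ∀ k, 0 < U k k) (hU : ∀ k l, 0 ≤ U k l)
    (A : ℕ → Type*) [∀ n, Ring (A n)] [∀ n, StarRing (A n)] [∀ n, Algebra ℂ (A n)]
    [∀ n, StarModule ℂ (A n)]
    (φ : ∀ n, A n →ₗ[ℂ] ℂ) (ψ : ∀ n, Fin n → A n →ₗ[ℂ] ℂ)
    (hφ : ∀ n, IsState (φ n)) (hψ : ∀ n j, IsState (ψ n j))
    (X : ∀ n, Fin n → Fin n → A n)
    -- matricial freeness of the self-adjoint array for each `n`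
    (hfree : ∀ n, IsMatriciallyFreeArray (X n) (φ n) (ψ n))
    -- centering
    (hmean : ∀ n i j, stateArray (φ n) (ψ n) (i, j) (X n i j) = 0)
    -- variances, constant on blocks
    (hvar : ∀ n k l (i j : Fin n), InBlock d n k i → InBlock d n l j →
      stateArray (φ n) (ψ n) (i, j) (X n i j ^ 2) = ((U k l / n : ℝ) : ℂ))
    -- uniform boundedness of moments
    (hbdd : ∀ m : ℕ, ∃ M : ℝ, 0 ≤ M ∧ ∀ n i j,
      ‖stateArray (φ n) (ψ n) (i, j) (X n i j ^ m)‖ ≤ M / (n : ℝ) ^ ((m : ℝ) / 2)) :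
    -- the continued fractions converge, uniformly on compact subsets of the upper half-plane
    (∀ i j, ∀ C : Set ℂ, IsCompact C → C ⊆ {z : ℂ | 0 < z.im} →
      TendstoUniformlyOn (fun m => approxK (Matrix.diagonal d * U) m i j)
        (fracK (Matrix.diagonal d * U) i j) atTop C) ∧
    ∃ μ : Fin r → Fin r → ProbabilityMeasure ℝ,
      -- to the K-transforms of probability measures `μ i j`
      (∀ i j, ∀ z : ℂ, 0 < z.im →
        kTransform (μ i j : Measure ℝ) z = fracK (Matrix.diagonal d * U) i j z) ∧
      ∃ μ₀ : ProbabilityMeasure ℝ,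
        IsBooleanConvolution (fun j => μ j j) μ₀ ∧
        (∀ z : ℂ, 0 < z.im → cauchyTransform (μ₀ : Measure ℝ) z =
          1 / (z - ∑ j, fracK (Matrix.diagonal d * U) j j z)) ∧
        -- weak convergence of the distributions, as functionals on polynomials
        (∀ m : ℕ, Integrable (fun x : ℝ => x ^ m) (μ₀ : Measure ℝ) ∧
          Tendsto (fun n => φ n (pseudomatrix (X n) ^ m)) atTop
            (𝓝 ((∫ x : ℝ, x ^ m ∂(μ₀ : Measure ℝ) : ℝ) : ℂ))) ∧
        -- and as probability measures
        (∀ ν : ℕ → ProbabilityMeasure ℝ,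
          (∀ n, RepresentsDistribution (φ n) (pseudomatrix (X n)) (ν n)) →
          Tendsto ν atTop (𝓝 μ₀)) := by
  set B : Matrix (Fin r) (Fin r) ℝ := Matrix.diagonal d * U with hBdef
  have hBij : ∀ i j, B i j = d i * U i j := fun i j => Matrix.diagonal_mul _ _ _ _
  have hB0 : ∀ i j, 0 ≤ B i j := fun i j => by
    rw [hBij]; exact mul_nonneg (hd i).le (hU i j)
  obtain ⟨R, S, g, hS, hunif, hmeas⟩ := exists_branch_limits B hB0
  have hopen : IsOpen {z : ℂ | 0 < z.im} := isOpen_lt continuous_const Complex.continuous_im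
  have hfrac : ∀ i j, ∀ z : ℂ, 0 < z.im → fracK B i j z = B i j * g i z := fun i j z hz =>
    ((hunif i j).tendsto_at hz).limUnder_eq
  have hBle : ∀ i j, B i j ≤ ∑ i, ∑ j, B i j := fun i j =>
    (Finset.single_le_sum (f := fun j => B i j) (fun j _ => hB0 i j) (Finset.mem_univ j)).trans
      (Finset.single_le_sum (f := fun i => ∑ j, B i j)
        (fun i _ => Finset.sum_nonneg fun j _ => hB0 i j) (Finset.mem_univ i))
  have hμ : ∀ i j, ∃ μ : ProbabilityMeasure ℝ, ∀ z : ℂ, 0 < z.im →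
      kTransform (μ : Measure ℝ) z = fracK B i j z := by
    intro i j
    -- A continuation with the single branch `i` of weight `B i j` has K-transform `B i j * g i`;
    -- the diagonal weights `B p p` give `μ₀` in the same way.
    obtain ⟨μ, -, -, hG⟩ := hmeas (Pi.single i (B i j))
      (fun p => by
        by_cases h : p = i
        · subst h; simpa using hB0 p j
        · simp [h])
      (by simpa using hBle i j)
    refine ⟨μ, fun z hz => ?_⟩
    have hsum : ∑ p, ((Pi.single i (B i j) : Fin r → ℝ) p : ℂ) * g p z = B i j * g i z := by
      rw [Finset.sum_eq_single_of_mem i (Finset.mem_univ i) fun p _ hp => by simp [hp]]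
      simp
    rw [kTransform, hG z hz, hsum, inv_inv, sub_sub_cancel, hfrac i j z hz]
  choose μ hμK using hμ
  obtain ⟨μ₀, hμ₀R, hμ₀mom, hμ₀G⟩ := hmeas (fun p => B p p) (fun p => hB0 p p)
    (Finset.sum_le_sum fun i _ =>
      Finset.single_le_sum (f := fun j => B i j) (fun j _ => hB0 i j) (Finset.mem_univ i))
  obtain ⟨S₀, hS₀⟩ := exists_branchDen_mul_eq_one (fun p => B p p) S
  have hdiag : ∀ z : ℂ, 0 < z.im → ∑ p, (B p p : ℂ) * g p z = ∑ p, fracK B p p z :=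
    fun z hz => Finset.sum_congr rfl fun p _ => (hfrac p p z hz).symm
  have hlim : ∀ m : ℕ, Tendsto (fun n => φ n (pseudomatrix (X n) ^ m)) atTop
      (𝓝 ((∫ x : ℝ, x ^ m ∂(μ₀ : Measure ℝ) : ℝ) : ℂ)) := by
    intro m
    choose e he using fun n => (hfree n).2
    choose blk hblk using fun n => exists_inBlock hd1 n
    have hmean' : ∀ n p, entryMoment (X n) (φ n) (ψ n) p 1 = 0 := fun n p => by
      rw [entryMoment, pow_one]; exact hmean n p.1 p.2
    have hrec := fun n => (he n).2.wordRecursion (hφ n).map_one (hmean' n)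
    have hmom : ∀ k, ∃ M : ℝ, 0 ≤ M ∧ ∀ n, 1 ≤ n → ∀ p,
        ‖entryMoment (X n) (φ n) (ψ n) p k‖ ≤ M * (√n)⁻¹ ^ k := by
      intro k
      obtain ⟨M, hM0, hM⟩ := hbdd k
      refine ⟨M, hM0, fun n _ p => (hM n p.1 p.2).trans (le_of_eq ?_)⟩
      rw [div_eq_mul_inv, inv_pow, Real.sqrt_eq_rpow, ← Real.rpow_mul_natCast n.cast_nonneg,
        one_div_mul_eq_div]
    have hF := limitRecursion_wordSeries (d := d) (U := U) (S := S) (S₀ := S₀)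
      (fun i => by simpa only [hBij] using hS i) (by simpa only [hBij] using hS₀)
    -- At the empty word no rescaling occurs: the functional is `φ(S^m)` and its limit is
    -- coefficient `m` of `S₀`.
    obtain ⟨δ, hδ, -, hδb⟩ := exists_word_limit hd hd1 hrec hmom hblk
      (fun n i j => hvar n _ _ i j (hblk n i) (hblk n j)) hF m 0
    rw [hμ₀mom S₀ hS₀ m, tendsto_iff_norm_sub_tendsto_zero]
    refine squeeze_zero' (Eventually.of_forall fun _ => norm_nonneg _) ?_ hδ
    filter_upwards [eventually_ge_atTop 1] with n hn
    have := hδb n hn [] rfl Admissible.nil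
    simpa [degreeOneWord, wordProd_nil, wordSeries, pseudomatrix] using this
  refine ⟨fun i j C hC hCU => ?_, μ, hμK, μ₀, fun z hz => ?_, fun z hz => ?_, fun m =>
    ⟨hμ₀R.integrable (by fun_prop), hlim m⟩, fun ν hν => ?_⟩
  · exact ((tendstoLocallyUniformlyOn_iff_forall_isCompact hopen).1 (hunif i j) C hCU hC).congr_right
      fun z hz => (hfrac i j z (hCU hz)).symm
  · rw [kTransform, hμ₀G z hz, inv_inv, sub_sub_cancel, hdiag z hz]
    exact Finset.sum_congr rfl fun j _ => (hμK j j z hz).symm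
  · rw [hμ₀G z hz, hdiag z hz, one_div]
  · refine tendsto_of_tendsto_moments hμ₀R ν (fun n k => (hν n k).1) fun k => ?_
    have := (Complex.continuous_re.tendsto _).comp (hlim k)
    simpa only [Function.comp_def, ← (hν _ k).2, Complex.ofReal_re] using this
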